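/- Let $k$ and $q$ be positive integers such that $p^3\mid q$ for every prime $p$ dividing $q$. For a positive integer $\ell$, let $\mathcal A(\ell)$ be the space of holomorphic cusp forms of weight $k$ on $\Gamma_0(\ell)$, with the Petersson inner product $$\langle f,g\rangle=\frac{V}{\operatorname{vol}(\Gamma_0(\ell)\backslash\mathbb H)}\int_{\Gamma_0(\ell)\backslash\mathbb H} \overline{f(z)}\,g(z)\,y^k\,\frac{dx\,dy}{y^2},\qquad z=x+iy,$$ where $\operatorname{vol}$ is taken with respect to $dx\,dy/y^2$ and $V>0$ is a constant independent of $\ell$. Let $\mathcal A^*(q)$ be the newspace, i.e. the orthogonal complement in $\mathcal A(q)$ of the span of the forms $z\mapsto d^{k/2}\varphi(dz)$ with $\varphi\in\mathcal A(\ell)$, where $\ell\ne q$ runs over the divisors of $q$ and $d$ over the divisors of $q/\ell$. Let $\mathcal B^*(q)$ be any orthonormal basis of $\mathcal A^*(q)$ and, for each $\ell\mid q$, let $\mathcal B(\ell)$ be any orthonormal basis of $\mathcal A(\ell)$. Write $\varphi(z)=\sum_{n\ge1}n^{k/2}\rho(n;\varphi)e^{2\pi i n z}$ for the Fourier expansion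 of a cusp form $\varphi$ and, for positive integers $m,n$, put $$\Delta^*(m,n;q)=\sum_{\varphi\in\mathcal B^*(q)}\rho(m;\varphi)\overline{\rho(n;\varphi)},\qquad \Delta(m,n;\ell)=\sum_{\varphi\in\mathcal B(\ell)}\rho(m;\varphi)\overline{\rho(n;\varphi)}.$$ Then for all positive integers $m,n$, $$\Delta^*(m,n;q)=\sum_{\substack{d\mid\gcd(m,n,q)\\ e\mid q}}\mu(d)\mu(e)\,\Delta\Big(\frac md,\frac nd;\frac q{de}\Big),$$ where $\mu$ is the Möbius function and terms with $\mu(d)\mu(e)=0$ are read as $0$ (in all other terms $de\mid q$). -/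

import Mathlib

open UpperHalfPlane CongruenceSubgroup
open scoped MatrixGroups ComplexConjugate

noncomputable section

namespace NewformAverage

/-- The space `𝒜(ℓ)` of holomorphic cusp forms of weight `k` on `Γ₀(ℓ)`. -/
abbrev CuspSpace (k ℓ : ℕ) : Type :=
  CuspForm (Gamma0 ℓ : Subgroup (GL (Fin 2) ℝ)) (k : ℤ)

/-- The integral of a `Γ₀(ℓ)`-invariant function `F` over `Γ₀(ℓ) \ ℍ` with respect to the
hyperbolic measure `dx dy / y²` (Mathlib's `volume` on `ℍ`). If `g` runs over representatives of
`SL₂(ℤ) / Γ₀(ℓ)`, then `g⁻¹` runs over representatives of `Γ₀(ℓ) \ SL₂(ℤ)`, and the translates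
`g⁻¹ 𝒟` of the standard fundamental domain of `SL₂(ℤ)` tile a fundamental domain of `Γ₀(ℓ)`
(note that `-1 ∈ Γ₀(ℓ)`). -/
def quotientIntegral (ℓ : ℕ) (F : ℍ → ℂ) : ℂ :=
  ∑ᶠ c : SL(2, ℤ) ⧸ Gamma0 ℓ, ∫ z in ModularGroup.fd, F (c.out⁻¹ • z)

/-- The Petersson inner product on `𝒜(ℓ)` for the hyperbolic measure on `Γ₀(ℓ) \ ℍ` rescaled to
have total volume `V`:
`⟨f, g⟩ = V / vol(Γ₀(ℓ) \ ℍ) * ∫_{Γ₀(ℓ) \ ℍ} conj (f z) * g z * y ^ k dx dy / y²`. -/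
def inner (V : ℝ) {k ℓ : ℕ} (f g : CuspSpace k ℓ) : ℂ :=
  (V : ℂ) / quotientIntegral ℓ (fun _ => 1) * quotientIntegral ℓ (petersson k f g)

/-- The function `φ|_d (z) = d ^ (k / 2) * φ (d z)` on `ℍ`, for `d ≥ 1`. -/
def dilate {k ℓ : ℕ} (d : ℕ) (φ : CuspSpace k ℓ) (z : ℍ) : ℂ :=
  (((d : ℝ) ^ ((k : ℝ) / 2) : ℝ) : ℂ) * φ (ofComplex ((d : ℂ) * (z : ℂ)))

/-- The oldspace of `𝒜(q)`: the span of the forms `φ|_d` for `φ ∈ 𝒜(ℓ)`, where `ℓ` runs over the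
divisors `ℓ ≠ q` of `q` and `d` over the divisors of `q / ℓ`. -/
def oldspace (k q : ℕ) : Submodule ℂ (CuspSpace k q) :=
  Submodule.span ℂ {ψ | ∃ ℓ d : ℕ, ℓ ∣ q ∧ ℓ ≠ q ∧ d ∣ q / ℓ ∧
    ∃ φ : CuspSpace k ℓ, (ψ : ℍ → ℂ) = dilate d φ}

/-- The newspace `𝒜*(q)`: the orthogonal complement of the oldspace in `𝒜(q)`. -/
def newspace (V : ℝ) (k q : ℕ) : Set (CuspSpace k q) :=
  {f | ∀ g ∈ oldspace k q, inner V g f = 0}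

/-- `B` is an orthonormal basis of the subspace `S` of `𝒜(ℓ)`. -/
structure IsOrthonormalBasis (V : ℝ) {k ℓ : ℕ} (S : Set (CuspSpace k ℓ))
    (B : Finset (CuspSpace k ℓ)) : Prop where
  subset : (B : Set (CuspSpace k ℓ)) ⊆ S
  norm_eq_one : ∀ f ∈ B, inner V f f = 1
  orthogonal : ∀ f ∈ B, ∀ g ∈ B, f ≠ g → inner V f g = 0
  spanning : S ⊆ Submodule.span ℂ (B : Set (CuspSpace k ℓ))

/-- The normalized Fourier coefficient `ρ(n; φ)`, `n ≥ 1`, where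
`φ(z) = ∑_{n ≥ 1} n ^ (k / 2) * ρ(n; φ) * exp (2 π i n z)`. -/
def rho {k ℓ : ℕ} (n : ℕ) (φ : CuspSpace k ℓ) : ℂ :=
  (qExpansion 1 φ).coeff n / (((n : ℝ) ^ ((k : ℝ) / 2) : ℝ) : ℂ)

/-- The sum of `ρ(m; φ) * conj (ρ(n; φ))` over `φ ∈ B`. -/
def coeffSum {k ℓ : ℕ} (B : Finset (CuspSpace k ℓ)) (m n : ℕ) : ℂ :=
  ∑ φ ∈ B, rho m φ * conj (rho n φ)

end NewformAverage

end

noncomputable section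

namespace NewformAverage

open MeasureTheory
open scoped ENNReal Pointwise ModularForm

/-! Let `R` in `𝒜(q)` represent the functional `rho n`: `⟨φ, R⟩ = conj (rho n φ)` for all `φ`.
Expanding in an orthonormal basis gives `Δ(m, n; q) = rho m R`, and in the same way `Δ*(m, n; q)` is
`rho m` of the orthogonal projection of `R` to the newspace. So it suffices to find this projection
explicitly and read off its coefficients.

For squarefree `d, e ∣ q`, let `P_{d,e} R` be the average of the translates of `R` by `lower (j q /
e) * upper (i / d)`, with `i` mod `d` and `j` mod `e`. The projection is `∑ μ(d) μ(e) P_{d,e} R`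
(`newPart`). Two facts show this. The terms other than `d = e = 1` are oldforms, because `P_{d,e} R`
is the dilation by `d` of a form of level `q / (d e)` (`exists_dilate_eq_average`). The sum is
orthogonal to each generator `g` of the oldspace, because `g` is fixed by `upper (1 / p)` or `lower
(q / p)` for some prime `p ∣ q`; then `P_{pd,e} R` and `P_{d,e} R`, respectively `P_{d,pe} R` and
`P_{d,e} R`, pair equally with `g`, and the Möbius signs cancel them (`newPart_mem_newspace`).

For the coefficients, write `P_{d,e} R = dilate d ψ`. Dilation is an isometry for the normalised
product and `dilate d φ` is fixed by all the translations, so `⟨φ, ψ⟩ = ⟨dilate d φ, R⟩ = conj (rho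
n (dilate d φ))`. Hence `ψ` represents `rho (n / d)` at level `q / (d e)`, or is `0` if `d ∤ n`, and
`rho m (P_{d,e} R)` is `Δ(m / d, n / d; q / (d e))` or `0` (`IsAverage.rho_eq`).

The cubes enter through `d ^ 2 * e ∣ q` and `d * e ^ 2 ∣ q`: they make the averages drop to level `q
/ (d e)` and make the two kinds of translation commute on `𝒜(q)`. Since rational matrices change the
level, the product is treated as a mean over `ℍ` that does not depend on the level. -/

lemma tsum_eq_tsum_cosets {G : Type*} [Group G] (H : Subgroup G) (f : G → ℝ≥0∞) :
    ∑' g, f g = ∑' c : G ⧸ H, ∑' h : H, f (c.out * h) := by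
  have hb : Function.Bijective (fun p : (G ⧸ H) × H => p.1.out * (p.2 : G)) := by
    constructor
    · rintro ⟨c, h⟩ ⟨c', h'⟩ e
      have hc : c = c' := by
        have := congrArg (QuotientGroup.mk (s := H)) e
        simpa [QuotientGroup.mk_mul_of_mem] using this
      subst hc
      simpa using e
    · intro g
      refine ⟨(QuotientGroup.mk g, ⟨(QuotientGroup.mk (s := H) g).out⁻¹ * g, ?_⟩), by simp⟩
      rw [← QuotientGroup.eq]
      simp
  rw [← (Equiv.ofBijective _ hb).tsum_eq, ENNReal.tsum_prod']
  rfl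

/-! ### Unfolding: comparison of two fundamental densities for a group action. -/

section Tilings

variable {G X : Type*} [Group G] [MulAction G X] [MeasurableSpace X] [MeasurableConstSMul G X]

/-- A density `w` whose translates under `H` add up to the constant `C` almost everywhere. -/
structure IsTiling (μ : Measure X) (H : Subgroup G) (w : X → ℝ≥0∞) (C : ℝ≥0∞) : Prop where
  measurable : Measurable w
  tsum_eq : ∀ᵐ x ∂μ, ∑' h : H, w (h • x) = C

variable {μ : Measure X} [SMulInvariantMeasure G X μ]

lemma IsTiling.conj {H : Subgroup G} {w : X → ℝ≥0∞} {C : ℝ≥0∞} (hw : IsTiling μ H w C) (g : G) :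
    IsTiling μ (ConjAct.toConjAct g • H) (fun x => w (g⁻¹ • x)) C where
  measurable := hw.measurable.comp (measurable_const_smul _)
  tsum_eq := by
    have h := (measurePreserving_smul g⁻¹ μ).quasiMeasurePreserving.ae hw.tsum_eq
    filter_upwards [h] with x hx
    rw [← hx, ← (Subgroup.equivSMul (ConjAct.toConjAct g) H).toEquiv.tsum_eq]
    refine tsum_congr fun h => ?_
    congr 1
    change g⁻¹ • ((ConjAct.toConjAct g • (h : G)) • x) = (h : G) • g⁻¹ • x
    rw [ConjAct.toConjAct_smul, smul_smul, smul_smul]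
    congr 1
    group

lemma IsTiling.of_le {H K : Subgroup G} [Countable K] (hHK : H ≤ K) {w : X → ℝ≥0∞} {C : ℝ≥0∞}
    (hC : C ≠ 0) (hw : IsTiling μ H w C) : ∃ C' ≠ 0, IsTiling μ K w C' := by
  let Q := K ⧸ H.subgroupOf K
  refine ⟨∑' _ : Q, C, ?_, hw.measurable, ?_⟩
  · rw [Ne, ENNReal.tsum_eq_zero]
    exact fun h => hC (h (QuotientGroup.mk 1))
  · have : Countable Q := inferInstanceAs (Countable (Quotient _))
    have hQ : ∀ᵐ x ∂μ, ∀ c : Q, ∑' h : H, w (h • ((c.out : G)⁻¹ • x)) = C := by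
      rw [ae_all_iff]
      exact fun c => (measurePreserving_smul (c.out : G)⁻¹ μ).quasiMeasurePreserving.ae hw.tsum_eq
    filter_upwards [hQ] with x hx
    -- Inversion turns `c.out * h` into `h⁻¹ * c.out⁻¹`, so that the element of `H` acts last and
    -- the inner sum is a sum over `H` at the point `c.out⁻¹ • x`.
    rw [← (Equiv.inv K).tsum_eq, tsum_eq_tsum_cosets (H.subgroupOf K)]
    refine tsum_congr fun c => ?_
    rw [← hx c, ← ((Subgroup.subgroupOfEquivOfLe hHK).toEquiv.trans (Equiv.inv H)).tsum_eq]
    refine tsum_congr fun h => ?_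
    congr 1
    change ((c.out * h : K)⁻¹ : G) • x = ((h : K) : G)⁻¹ • (c.out : G)⁻¹ • x
    rw [smul_smul]
    congr 1
    push_cast
    group

/-- Unfolding: insert `C' = ∑ w' (h • x)`, exchange sum and integral, and substitute `x ↦ h⁻¹ • x`;
the result is symmetric in the two densities. -/
lemma IsTiling.mul_setLIntegral_eq {H : Subgroup G} [Countable H] {w w' : X → ℝ≥0∞} {C C' : ℝ≥0∞}
    (hw : IsTiling μ H w C) (hw' : IsTiling μ H w' C') {A : Set X} (hA : MeasurableSet A)
    (hinv : ∀ h ∈ H, ∀ x, h • x ∈ A ↔ x ∈ A) :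
    C' * ∫⁻ x in A, w x ∂μ = C * ∫⁻ x in A, w' x ∂μ := by
  have key : ∀ {u v : X → ℝ≥0∞} {D : ℝ≥0∞}, Measurable u → IsTiling μ H v D →
      D * ∫⁻ x in A, u x ∂μ = ∑' h : H, ∫⁻ x in A, u x * v (h • x) ∂μ := by
    intro u v D hu hv
    rw [← lintegral_tsum (f := fun (h : H) x => u x * v (h • x)) fun h => (hu.mul
      (hv.measurable.comp (measurable_const_smul (h : G)))).aemeasurable, ← lintegral_const_mul _ hu]
    refine lintegral_congr_ae (ae_restrict_of_ae ?_)
    filter_upwards [hv.tsum_eq] with x hx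
    rw [ENNReal.tsum_mul_left, hx, mul_comm]
  rw [key hw.measurable hw', key hw'.measurable hw, ← (Equiv.inv H).tsum_eq]
  refine tsum_congr fun h => ?_
  rw [← (measurePreserving_smul (h : G) μ).setLIntegral_comp_preimage hA
    (f := fun x => w x * w' (Equiv.inv H h • x))
    (hw.measurable.mul (hw'.measurable.comp (measurable_const_smul ((h⁻¹ : H) : G))))]
  have hAh : (fun x => (h : G) • x) ⁻¹' A = A := Set.ext fun x => hinv h h.2 x
  rw [hAh]
  refine lintegral_congr fun x => ?_
  have : ((Equiv.inv H h : H) • ((h : G) • x)) = x := by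
    change ((h⁻¹ : H) : G) • ((h : G) • x) = x
    simp
  rw [this, mul_comm]
  rfl

/-- The integral of an invariant function against a tiling density depends, up to normalisation,
neither on the density nor on the group. -/
lemma IsTiling.integral_mul_eq {H : Subgroup G} [Countable H] {w w' : X → ℝ≥0∞} {C C' : ℝ≥0∞}
    (hw : IsTiling μ H w C) (hw' : IsTiling μ H w' C') (hC : C ≠ 0) (hC_top : C ≠ ∞)
    (hw_zero : ∫⁻ x, w x ∂μ ≠ 0) (hw'_top : ∫⁻ x, w' x ∂μ ≠ ∞)
    {F : X → ℂ} (hF : Measurable F) (hinv : ∀ h ∈ H, ∀ x, F (h • x) = F x) :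
    (∫ x, F x ∂μ.withDensity w') * ((μ.withDensity w).real Set.univ : ℂ) =
      (∫ x, F x ∂μ.withDensity w) * ((μ.withDensity w').real Set.univ : ℂ) := by
  have hA : ∀ A, MeasurableSet A → (∀ h ∈ H, ∀ x, h • x ∈ A ↔ x ∈ A) →
      C' * μ.withDensity w A = C * μ.withDensity w' A := fun A hA hi => by
    rw [withDensity_apply _ hA, withDensity_apply _ hA]
    exact hw.mul_setLIntegral_eq hw' hA hi
  have huniv := hA Set.univ .univ (by simp)
  -- The constant produced by `IsTiling.of_le` is a possibly infinite sum; the finite mass of `w'`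
  -- and the nonzero mass of `w` force it to be finite.
  have hC'_top : C' ≠ ∞ := by
    rintro rfl
    rw [ENNReal.top_mul (by simpa [withDensity_apply] using hw_zero)] at huniv
    exact ENNReal.mul_ne_top hC_top (by simpa [withDensity_apply] using hw'_top) huniv.symm
  -- The preimages `F⁻¹ s` are invariant sets, so the laws of `F` under the two measures are
  -- proportional. No integrability of `F` is needed.
  have hmap : (μ.withDensity w').map F = (C' / C) • (μ.withDensity w).map F := by
    ext s hs
    rw [Measure.smul_apply, Measure.map_apply hF hs, Measure.map_apply hF hs, smul_eq_mul,
      ENNReal.div_eq_inv_mul, mul_assoc, hA _ (hF hs) (fun h hh x => by simp [hinv h hh]),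
      ← mul_assoc, ENNReal.inv_mul_cancel hC hC_top, one_mul]
  have h1 : ∫ x, F x ∂μ.withDensity w' = (C' / C).toReal • ∫ x, F x ∂μ.withDensity w := by
    rw [← integral_map (φ := F) (f := fun z => z) hF.aemeasurable
        measurable_id.aestronglyMeasurable,
      ← integral_map (φ := F) (f := fun z => z) hF.aemeasurable
        measurable_id.aestronglyMeasurable, hmap, integral_smul_measure]
  have h2 : (μ.withDensity w').real Set.univ = (C' / C).toReal * (μ.withDensity w).real Set.univ := by
    rw [Measure.real, Measure.real, ← ENNReal.toReal_mul, ENNReal.div_eq_inv_mul, mul_assoc, huniv,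
      ← mul_assoc, ENNReal.inv_mul_cancel hC hC_top, one_mul]
  rw [h1, h2, Complex.real_smul]
  push_cast
  ring

end Tilings

/-! ### The standard fundamental domain of `SL₂(ℤ)`: boundary, volume and tiling. -/

section FundamentalDomain

lemma volume_eq_zero_of_image {s : Set ℍ} (hs : volume ((↑) '' s : Set ℂ) = 0) : volume s = 0 := by
  rw [UpperHalfPlane.volume_eq_lintegral]
  exact setLIntegral_measure_zero _ _ hs

lemma volume_re_eq (c : ℝ) : volume {z : ℂ | z.re = c} = 0 := by
  have h : {z : ℂ | z.re = c} = Complex.measurableEquivRealProd ⁻¹' ({c} ×ˢ Set.univ) := by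
    ext z
    simp [Complex.measurableEquivRealProd]
  rw [h, Complex.volume_preserving_equiv_real_prod.measure_preimage_equiv, Measure.volume_eq_prod,
    Measure.prod_prod]
  simp

lemma volume_fd_diff_fdo : volume (ModularGroup.fd \ ModularGroup.fdo) = 0 := by
  refine volume_eq_zero_of_image (measure_mono_null (t := Metric.sphere (0 : ℂ) 1 ∪
    ({z : ℂ | z.re = 1 / 2} ∪ {z : ℂ | z.re = -(1 / 2)})) ?_ ?_)
  · rintro _ ⟨z, ⟨⟨h1, h2⟩, h3⟩, rfl⟩
    by_cases h : |z.re| = 1 / 2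
    · right
      rcases abs_choice z.re with h' | h'
      · left
        simpa [h'] using h
      · right
        simp only [Set.mem_ofPred_eq, coe_re]
        linarith
    · left
      have h4 : ¬ 1 < Complex.normSq (z : ℂ) := fun h4 => h3 ⟨h4, lt_of_le_of_ne h2 h⟩
      have h5 : Complex.normSq (z : ℂ) = 1 := le_antisymm (not_lt.mp h4) h1
      rw [Complex.normSq_eq_norm_sq] at h5
      simpa using (pow_eq_one_iff_of_nonneg (norm_nonneg (z : ℂ)) two_ne_zero).mp h5
  · rw [measure_union_null_iff, measure_union_null_iff]
    exact ⟨Measure.addHaar_sphere volume _ _, volume_re_eq _, volume_re_eq _⟩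

/-- The domain lies in the strip `|x| ≤ 1/2`, `y > 1/2`, over which `y⁻²` is integrable. -/
lemma volume_fd_lt_top : volume (ModularGroup.fd) < ∞ := by
  let g : ℝ → ℝ≥0∞ := (Set.Icc (-(1 / 2)) (1 / 2)).indicator 1
  let h : ℝ → ℝ≥0∞ := (Set.Ioi (1 / 2)).indicator fun y => ENNReal.ofReal (y ^ (-2 : ℝ))
  have hg : Measurable g := measurable_one.indicator measurableSet_Icc
  have hh : Measurable h :=
    (Measurable.ennreal_ofReal (by fun_prop)).indicator measurableSet_Ioi
  have hle : volume ModularGroup.fd ≤ ∫⁻ z : ℂ, g z.re * h z.im := by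
    rw [UpperHalfPlane.volume_eq_lintegral]
    refine (setLIntegral_mono' ?_ ?_).trans (setLIntegral_le_lintegral _ _)
    · exact measurableEmbedding_coe.measurableSet_image.mpr
        ModularGroup.isClosed_fd.measurableSet
    · rintro _ ⟨z, hz, rfl⟩
      have h1 : z.re ∈ Set.Icc (-(1 / 2) : ℝ) (1 / 2) := abs_le.mp hz.2
      have h2 : z.im ∈ Set.Ioi (1 / 2 : ℝ) := by
        have := ModularGroup.three_le_four_mul_im_sq_of_mem_fd hz
        rw [Set.mem_Ioi]
        nlinarith [z.im_pos]
      simp only [g, h, coe_re, coe_im, Set.indicator_of_mem h1, Set.indicator_of_mem h2,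
        Pi.one_apply, one_mul]
      rw [Real.rpow_neg z.im_pos.le, ENNReal.ofReal, ENNReal.coe_le_coe]
      refine le_of_eq ?_
      ext
      simp [Real.toNNReal_of_nonneg, z.im_pos.le, abs_of_pos z.im_pos]
  refine hle.trans_lt ?_
  have e : ∫⁻ z : ℂ, g z.re * h z.im = ∫⁻ p : ℝ × ℝ, g p.1 * h p.2 := by
    rw [← Complex.volume_preserving_equiv_real_prod.lintegral_comp_emb
      Complex.measurableEquivRealProd.measurableEmbedding]
    rfl
  rw [e, Measure.volume_eq_prod, lintegral_prod_mul hg.aemeasurable hh.aemeasurable]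
  refine ENNReal.mul_lt_top ?_ ?_
  · simp [g, lintegral_indicator measurableSet_Icc]
  · rw [lintegral_indicator measurableSet_Ioi]
    have := (integrableOn_Ioi_rpow_of_lt (a := -2) (by norm_num) (c := 1 / 2) (by norm_num))
    exact this.lintegral_lt_top 

lemma volume_fd_ne_zero : volume (ModularGroup.fd) ≠ 0 := by
  intro h
  rw [UpperHalfPlane.volume_eq_lintegral] at h
  have hmeas : MeasurableSet ((↑) '' ModularGroup.fd : Set ℂ) :=
    measurableEmbedding_coe.measurableSet_image.mpr ModularGroup.isClosed_fd.measurableSet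
  rw [setLIntegral_eq_zero_iff hmeas (by fun_prop)] at h
  have h0 : volume ((↑) '' ModularGroup.fd : Set ℂ) = 0 := by
    refine measure_mono_null ?_ h
    rintro _ ⟨z, hz, rfl⟩
    intro hzero
    have := hzero ⟨z, hz, rfl⟩
    simp [z.im_ne_zero] at this
  have ho : IsOpen ((↑) '' ModularGroup.fdo : Set ℂ) :=
    isOpenEmbedding_coe.isOpenMap _ ModularGroup.isOpen_fdo
  have hne : ((↑) '' ModularGroup.fdo : Set ℂ).Nonempty := by
    rw [ModularGroup.coe_fdo]
    exact ⟨2 * Complex.I, by simp, by simp, by simp⟩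
  exact (ho.measure_pos volume hne).ne'
    (measure_mono_null (Set.image_mono ModularGroup.fdo_subset_fd) h0)

instance : SMulInvariantMeasure SL(2, ℤ) ℍ volume where
  measure_preimage_smul g s _ :=
    measure_preimage_smul volume (Matrix.SpecialLinearGroup.mapGL ℝ g) s

instance : MeasurableConstSMul SL(2, ℤ) ℍ where
  measurable_const_smul g := (continuous_const_smul (Matrix.SpecialLinearGroup.mapGL ℝ g)).measurable

instance : Countable SL(2, ℤ) :=
  have : Countable (Matrix (Fin 2) (Fin 2) ℤ) := inferInstanceAs (Countable (Fin 2 → Fin 2 → ℤ))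
  Subtype.countable

/-- The value is 2 because `g` and `-g` act alike; off the null set of translates of the boundary no
other pair meets the domain. -/
lemma tsum_indicator_fd :
    ∀ᵐ z : ℍ, ∑' g : SL(2, ℤ), ModularGroup.fd.indicator (1 : ℍ → ℝ≥0∞) (g • z) = 2 := by
  have hN : ∀ᵐ z : ℍ, ∀ g : SL(2, ℤ), g • z ∉ ModularGroup.fd \ ModularGroup.fdo := by
    rw [ae_all_iff]
    exact fun g => (measurePreserving_smul g volume).quasiMeasurePreserving.ae
      (measure_eq_zero_iff_ae_notMem.mp volume_fd_diff_fdo)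
  filter_upwards [hN] with z hz
  obtain ⟨g₀, hg₀⟩ := ModularGroup.exists_smul_mem_fd z
  have hg₀' : g₀ • z ∈ ModularGroup.fdo := by
    by_contra h
    exact hz g₀ ⟨hg₀, h⟩
  have hmem : ∀ g : SL(2, ℤ), g • z ∈ ModularGroup.fd ↔ g ∈ ({g₀, -g₀} : Finset SL(2, ℤ)) := by
    intro g
    constructor
    · intro hg
      have : (g * g₀⁻¹) • g₀ • z ∈ ModularGroup.fd := by simpa [smul_smul] using hg
      rcases ModularGroup.eq_one_or_neg_one_of_mem_fdo_mem_fd hg₀' this with h | h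
      · simp [mul_inv_eq_one.mp h]
      · have : g = -g₀ := by simpa using mul_inv_eq_iff_eq_mul.mp h
        simp [this]
    · intro hg
      rcases Finset.mem_insert.mp hg with rfl | hg
      · exact hg₀
      · rw [Finset.mem_singleton.mp hg, ModularGroup.SL_neg_smul]
        exact hg₀
  have hne : g₀ ≠ -g₀ := by
    intro h
    have h2 : ∀ i j, g₀ i j = 0 := fun i j => by
      have := congrArg (fun g : SL(2, ℤ) => g i j) h
      simp at this
      omega
    have := g₀.det_coe
    rw [Matrix.det_fin_two] at this
    simp [h2] at this
  rw [tsum_eq_sum (s := {g₀, -g₀}), Finset.sum_pair hne]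
  · rw [Set.indicator_of_mem ((hmem _).mpr (by simp)), Set.indicator_of_mem ((hmem _).mpr (by simp))]
    norm_num
  · intro g hg
    exact Set.indicator_of_notMem (fun h => hg ((hmem g).mp h)) _

end FundamentalDomain

/-! ### Mean values over fundamental domains of finite-index subgroups. -/

section LevelMean

open Matrix.SpecialLinearGroup

/-- The indicator function, counted with multiplicity, of the union of the translates of the
standard fundamental domain by representatives of `Γ \ SL₂(ℤ)`. -/
def cosetDensity (Γ : Subgroup SL(2, ℤ)) (z : ℍ) : ℝ≥0∞ :=
  ∑' c : SL(2, ℤ) ⧸ Γ, ModularGroup.fd.indicator 1 (c.out • z)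

/-- The hyperbolic measure on a fundamental domain of `Γ`. -/
def cosetMeasure (Γ : Subgroup SL(2, ℤ)) : Measure ℍ :=
  volume.withDensity (cosetDensity Γ)

/-- The mean value of `F` over a fundamental domain of `Γ`. -/
def levelMean (Γ : Subgroup SL(2, ℤ)) (F : ℍ → ℂ) : ℂ :=
  (∫ z, F z ∂cosetMeasure Γ) / ((cosetMeasure Γ).real Set.univ : ℂ)

variable (Γ : Subgroup SL(2, ℤ))

instance countable_quotient : Countable (SL(2, ℤ) ⧸ Γ) := inferInstanceAs (Countable (Quotient _))

instance countable_map : Countable (Γ.map (mapGL ℝ)) :=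
  (Γ.equivMapOfInjective _ (mapGL_injective (S := ℝ))).symm.injective.countable

lemma measurable_indicator_fd : Measurable (ModularGroup.fd.indicator (1 : ℍ → ℝ≥0∞)) :=
  measurable_one.indicator ModularGroup.isClosed_fd.measurableSet

lemma measurable_cosetDensity : Measurable (cosetDensity Γ) :=
  Measurable.tsum fun _ => measurable_indicator_fd.comp (measurable_const_smul _)

lemma isTiling_cosetDensity :
    IsTiling (volume : Measure ℍ) (Γ.map (mapGL ℝ)) (cosetDensity Γ) 2 where
  measurable := measurable_cosetDensity Γ
  tsum_eq := by
    filter_upwards [tsum_indicator_fd] with z hz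
    rw [← hz, tsum_eq_tsum_cosets Γ,
      ← (Γ.equivMapOfInjective _ (mapGL_injective (S := ℝ))).toEquiv.tsum_eq, ENNReal.tsum_comm]
    refine tsum_congr fun h => tsum_congr fun c => ?_
    rw [mul_smul]
    rfl

lemma cosetMeasure_eq_sum : cosetMeasure Γ =
    Measure.sum fun c : SL(2, ℤ) ⧸ Γ => volume.restrict ((c.out • ·) ⁻¹' ModularGroup.fd) := by
  have h : cosetDensity Γ = ∑' c : SL(2, ℤ) ⧸ Γ,
      ((c.out • ·) ⁻¹' ModularGroup.fd).indicator (1 : ℍ → ℝ≥0∞) := by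
    ext z
    rw [ENNReal.tsum_apply]
    rfl
  have hm (c : SL(2, ℤ) ⧸ Γ) : MeasurableSet ((c.out • ·) ⁻¹' ModularGroup.fd : Set ℍ) :=
    measurable_const_smul _ ModularGroup.isClosed_fd.measurableSet
  rw [cosetMeasure, h, withDensity_tsum fun c => measurable_one.indicator (hm c)]
  exact congrArg _ (funext fun c => withDensity_indicator_one (hm c))

lemma cosetMeasure_univ : cosetMeasure Γ Set.univ =
    ∑' _ : SL(2, ℤ) ⧸ Γ, volume ModularGroup.fd := by
  rw [cosetMeasure_eq_sum, Measure.sum_apply _ .univ]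
  refine tsum_congr fun c => ?_
  rw [Measure.restrict_apply_univ, measure_preimage_smul]

lemma cosetMeasure_univ_ne_zero : cosetMeasure Γ Set.univ ≠ 0 := by
  rw [cosetMeasure_univ, Ne, ENNReal.tsum_eq_zero]
  exact fun h => volume_fd_ne_zero (h (QuotientGroup.mk 1))

instance isFiniteMeasure_cosetMeasure [Γ.FiniteIndex] : IsFiniteMeasure (cosetMeasure Γ) where
  measure_univ_lt_top := by
    have := Fintype.ofFinite (SL(2, ℤ) ⧸ Γ)
    rw [cosetMeasure_univ, tsum_fintype]
    exact ENNReal.sum_lt_top.mpr fun _ _ => volume_fd_lt_top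

lemma integral_cosetMeasure [Γ.FiniteIndex] {F : ℍ → ℂ} (hF : Measurable F)
    {C : ℝ} (hC : ∀ z, ‖F z‖ ≤ C) :
    ∫ z, F z ∂cosetMeasure Γ =
      ∑ᶠ c : SL(2, ℤ) ⧸ Γ, ∫ z in ModularGroup.fd, F (c.out⁻¹ • z) := by
  have := Fintype.ofFinite (SL(2, ℤ) ⧸ Γ)
  have hfin : ∀ c : SL(2, ℤ) ⧸ Γ,
      IsFiniteMeasure (volume.restrict ((c.out • ·) ⁻¹' ModularGroup.fd : Set ℍ)) := fun c =>
    ⟨by simpa [measure_preimage_smul] using volume_fd_lt_top⟩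
  rw [cosetMeasure_eq_sum, Measure.sum_fintype, finsum_eq_sum_of_fintype,
    integral_finsetSum_measure]
  · refine Finset.sum_congr rfl fun c _ => ?_
    rw [← (measurePreserving_smul c.out (volume : Measure ℍ)).setIntegral_preimage_emb
      (measurableEmbedding_const_smul _) (fun z => F (c.out⁻¹ • z))]
    simp only [inv_smul_smul]
  · exact fun c _ => Integrable.of_bound hF.aestronglyMeasurable C (.of_forall hC)

variable {Γ}

/-- Pushing the measure of `Γ'` forward by `β` gives a tiling density for `β Γ' β⁻¹`, hence for the
larger group `Γ`; two tilings of `Γ` yield the same mean. -/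
lemma levelMean_comp {Γ' : Subgroup SL(2, ℤ)} [Γ.FiniteIndex] [Γ'.FiniteIndex] (β : GL (Fin 2) ℝ)
    (hβ : ∀ γ ∈ Γ', β * mapGL ℝ γ * β⁻¹ ∈ Γ.map (mapGL ℝ)) {F : ℍ → ℂ} (hF : Measurable F)
    (hinv : ∀ γ ∈ Γ, ∀ z : ℍ, F (γ • z) = F z) :
    levelMean Γ' (fun z => F (β • z)) = levelMean Γ F := by
  let w' : ℍ → ℝ≥0∞ := fun z => cosetDensity Γ' (β⁻¹ • z)
  have hle : ConjAct.toConjAct β • Γ'.map (mapGL ℝ) ≤ Γ.map (mapGL ℝ) := by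
    rintro _ ⟨_, ⟨γ, hγ, rfl⟩, rfl⟩
    exact hβ γ hγ
  obtain ⟨C', -, hw'⟩ := ((isTiling_cosetDensity Γ').conj β).of_le hle two_ne_zero
  have hmap : (cosetMeasure Γ').map (β • ·) = volume.withDensity w' := by
    ext s hs
    have hm : Measurable (fun z : ℍ => β • z) := measurable_const_smul β
    rw [Measure.map_apply hm hs, cosetMeasure, withDensity_apply _ (hm hs),
      withDensity_apply _ hs, ← (measurePreserving_smul β
        (volume : Measure ℍ)).setLIntegral_comp_preimage hs hw'.measurable]
    simp
  have huniv : (volume.withDensity w') Set.univ = cosetMeasure Γ' Set.univ := by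
    rw [← hmap, Measure.map_apply (measurable_const_smul β) .univ, Set.preimage_univ]
  have key := (isTiling_cosetDensity Γ).integral_mul_eq hw' two_ne_zero (by simp)
    (by simpa [cosetMeasure, withDensity_apply] using cosetMeasure_univ_ne_zero Γ)
    (by
      rw [← setLIntegral_univ, ← withDensity_apply _ .univ, huniv]
      exact measure_ne_top _ _) hF
    (by
      rintro _ ⟨γ, hγ, rfl⟩ z
      exact hinv γ hγ z)
  rw [measureReal_def, measureReal_def, huniv, ← hmap,
    integral_map (measurable_const_smul β).aemeasurable hF.aestronglyMeasurable] at key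
  have h1 : ((cosetMeasure Γ).real Set.univ : ℂ) ≠ 0 :=
    Complex.ofReal_ne_zero.mpr (ENNReal.toReal_ne_zero.mpr
      ⟨cosetMeasure_univ_ne_zero Γ, measure_ne_top _ _⟩)
  have h2 : ((cosetMeasure Γ').real Set.univ : ℂ) ≠ 0 :=
    Complex.ofReal_ne_zero.mpr (ENNReal.toReal_ne_zero.mpr
      ⟨cosetMeasure_univ_ne_zero Γ', measure_ne_top _ _⟩)
  rw [levelMean, levelMean, div_eq_div_iff h2 h1]
  exact key

end LevelMean

/-! ### The level-free mean and its invariance under `GL₂(ℚ)`. -/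

section Mean

open Matrix.SpecialLinearGroup

/-- The mean value over `ℍ` of a function invariant under some principal congruence subgroup. -/
def mean (F : ℍ → ℂ) : ℂ :=
  open scoped Classical in
  if h : ∃ N ≠ 0, ∀ γ ∈ Gamma N, ∀ z : ℍ, F (γ • z) = F z then levelMean (Gamma h.choose) F else 0

/-- The embedding of `GL₂(ℚ)` into `GL₂(ℝ)`. -/
abbrev toReal : GL (Fin 2) ℚ →* GL (Fin 2) ℝ := Matrix.GeneralLinearGroup.map (Rat.castHom ℝ)

lemma Gamma_le_Gamma_of_dvd {M N : ℕ} (h : M ∣ N) : Gamma N ≤ Gamma M := by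
  intro γ hγ
  rw [Gamma_mem] at hγ ⊢
  have hc (a : ℤ) : ((a : ZMod N).cast : ZMod M) = a := ZMod.cast_intCast h a
  obtain ⟨h1, h2, h3, h4⟩ := hγ
  refine ⟨?_, ?_, ?_, ?_⟩ <;> rw [← hc]
  · rw [h1, ZMod.cast_one h]
  · rw [h2, ZMod.cast_zero]
  · rw [h3, ZMod.cast_zero]
  · rw [h4, ZMod.cast_one h]

lemma levelMean_eq_of_le {Γ Γ' : Subgroup SL(2, ℤ)} [Γ.FiniteIndex] [Γ'.FiniteIndex] (h : Γ' ≤ Γ)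
    {F : ℍ → ℂ} (hF : Measurable F) (hinv : ∀ γ ∈ Γ, ∀ z : ℍ, F (γ • z) = F z) :
    levelMean Γ' F = levelMean Γ F := by
  simpa using levelMean_comp 1 (fun γ hγ => ⟨γ, h hγ, by simp⟩) hF hinv

/-- The level chosen in `mean` is immaterial: two levels `M` and `N` are compared through `Gamma (M
* N)`. -/
lemma mean_eq {Γ : Subgroup SL(2, ℤ)} (hΓ : IsCongruenceSubgroup Γ)
    {F : ℍ → ℂ} (hF : Measurable F) (hinv : ∀ γ ∈ Γ, ∀ z : ℍ, F (γ • z) = F z) :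
    mean F = levelMean Γ F := by
  have := hΓ.finiteIndex
  obtain ⟨N, hN, hNΓ⟩ := hΓ
  have hex : ∃ N ≠ 0, ∀ γ ∈ Gamma N, ∀ z : ℍ, F (γ • z) = F z :=
    ⟨N, hN, fun γ hγ => hinv γ (hNΓ hγ)⟩
  rw [mean, dif_pos hex]
  obtain ⟨hM, hinvM⟩ := hex.choose_spec
  set M := hex.choose
  have : NeZero N := ⟨hN⟩
  have : NeZero M := ⟨hM⟩
  have : NeZero (M * N) := ⟨mul_ne_zero hM hN⟩
  rw [← levelMean_eq_of_le (Gamma_le_Gamma_of_dvd (dvd_mul_right M N)) hF hinvM,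
    levelMean_eq_of_le ((Gamma_le_Gamma_of_dvd (dvd_mul_left N M)).trans hNΓ) hF hinv]

lemma mean_comp (β : GL (Fin 2) ℚ) {F : ℍ → ℂ} (hF : Measurable F)
    (hlevel : ∃ N ≠ 0, ∀ γ ∈ Gamma N, ∀ z : ℍ, F (γ • z) = F z) :
    mean (fun z => F (toReal β • z)) = mean F := by
  obtain ⟨N, hN, hinv⟩ := hlevel
  have : NeZero N := ⟨hN⟩
  obtain ⟨M, hM, hle⟩ := exists_Gamma_le_conj' β N
  have : NeZero M := ⟨hM⟩
  have hβ : ∀ γ ∈ Gamma M, toReal β * mapGL ℝ γ * (toReal β)⁻¹ ∈ (Gamma N).map (mapGL ℝ) :=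
    fun γ hγ => hle ⟨mapGL ℝ γ, ⟨γ, hγ, rfl⟩, rfl⟩
  rw [mean_eq (Gamma_is_cong_sub N) hF hinv, ← levelMean_comp (toReal β) hβ hF hinv]
  refine mean_eq (Gamma_is_cong_sub M) (hF.comp (measurable_const_smul _)) fun γ hγ z => ?_
  obtain ⟨δ, hδ, e⟩ := hβ γ hγ
  rw [← hinv δ hδ (toReal β • z)]
  congr 1
  change toReal β • mapGL ℝ γ • z = mapGL ℝ δ • toReal β • z
  rw [e, smul_smul, smul_smul, inv_mul_cancel_right]

lemma exists_common_level {F G : ℍ → ℂ}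
    (hF : ∃ N ≠ 0, ∀ γ ∈ Gamma N, ∀ z : ℍ, F (γ • z) = F z)
    (hG : ∃ N ≠ 0, ∀ γ ∈ Gamma N, ∀ z : ℍ, G (γ • z) = G z) :
    ∃ N ≠ 0, ∀ γ ∈ Gamma N, ∀ z : ℍ, F (γ • z) = F z ∧ G (γ • z) = G z := by
  obtain ⟨M, hM, hF⟩ := hF
  obtain ⟨N, hN, hG⟩ := hG
  exact ⟨M * N, mul_ne_zero hM hN, fun γ hγ z =>
    ⟨hF γ (Gamma_le_Gamma_of_dvd (dvd_mul_right M N) hγ) z,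
      hG γ (Gamma_le_Gamma_of_dvd (dvd_mul_left N M) hγ) z⟩⟩

lemma mean_add {F G : ℍ → ℂ} (hF : Measurable F) (hG : Measurable G)
    (hFb : ∃ C : ℝ, ∀ z, ‖F z‖ ≤ C) (hGb : ∃ C : ℝ, ∀ z, ‖G z‖ ≤ C)
    (hFl : ∃ N ≠ 0, ∀ γ ∈ Gamma N, ∀ z : ℍ, F (γ • z) = F z)
    (hGl : ∃ N ≠ 0, ∀ γ ∈ Gamma N, ∀ z : ℍ, G (γ • z) = G z) :
    mean (fun z => F z + G z) = mean F + mean G := by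
  obtain ⟨N, hN, h⟩ := exists_common_level hFl hGl
  obtain ⟨C, hC⟩ := hFb
  obtain ⟨D, hD⟩ := hGb
  have : NeZero N := ⟨hN⟩
  have hcong := Gamma_is_cong_sub N
  rw [mean_eq hcong hF fun γ hγ z => (h γ hγ z).1, mean_eq hcong hG fun γ hγ z => (h γ hγ z).2,
    mean_eq (F := fun z => F z + G z) hcong (hF.add hG) fun γ hγ z => by simp only [h γ hγ z],
    levelMean, levelMean, levelMean, integral_add, add_div]
  · exact Integrable.of_bound hF.aestronglyMeasurable C (.of_forall hC)
  · exact Integrable.of_bound hG.aestronglyMeasurable D (.of_forall hD)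

lemma mean_const_mul (c : ℂ) {F : ℍ → ℂ} (hF : Measurable F)
    (hFl : ∃ N ≠ 0, ∀ γ ∈ Gamma N, ∀ z : ℍ, F (γ • z) = F z) :
    mean (fun z => c * F z) = c * mean F := by
  obtain ⟨N, hN, h⟩ := hFl
  have : NeZero N := ⟨hN⟩
  have hcong := Gamma_is_cong_sub N
  rw [mean_eq hcong hF h, mean_eq hcong (hF.const_mul c) fun γ hγ z => by simp only [h γ hγ z],
    levelMean, levelMean, integral_const_mul, mul_div_assoc]

lemma mean_conj {F : ℍ → ℂ} (hF : Measurable F)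
    (hFl : ∃ N ≠ 0, ∀ γ ∈ Gamma N, ∀ z : ℍ, F (γ • z) = F z) :
    mean (fun z => conj (F z)) = conj (mean F) := by
  obtain ⟨N, hN, h⟩ := hFl
  have : NeZero N := ⟨hN⟩
  have hcong := Gamma_is_cong_sub N
  rw [mean_eq hcong hF h, mean_eq (F := fun z => conj (F z)) hcong (Complex.continuous_conj.measurable.comp hF)
    fun γ hγ z => by simp only [h γ hγ z], levelMean, levelMean, integral_conj, map_div₀,
    Complex.conj_ofReal]

end Mean

/-! ### The scalar product on forms of unspecified level, and slashing by rational matrices. -/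

section Automorphic

open Matrix.SpecialLinearGroup

variable {k : ℤ}

lemma norm_petersson (f g : ℍ → ℂ) (z : ℍ) : ‖petersson k f g z‖ = ‖f z‖ * ‖g z‖ * z.im ^ k := by
  simp [petersson, abs_of_pos z.im_pos]

/-- Continuous functions of weight `k` for some principal congruence subgroup such that
`|f(z)|² y ^ k` is bounded. -/
def boundedForms (k : ℤ) : Submodule ℂ (ℍ → ℂ) where
  carrier := {f | Continuous f ∧ (∃ N ≠ 0, ∀ γ ∈ Gamma N, f ∣[k] γ = f) ∧
    ∃ C : ℝ, ∀ z, ‖petersson k f f z‖ ≤ C}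
  zero_mem' := ⟨continuous_zero, ⟨1, one_ne_zero, by simp⟩, 0, by simp [petersson]⟩
  add_mem' := by
    rintro f g ⟨hf, ⟨M, hM, hfM⟩, C, hC⟩ ⟨hg, ⟨N, hN, hgN⟩, D, hD⟩
    refine ⟨hf.add hg, ⟨M * N, mul_ne_zero hM hN, fun γ hγ => ?_⟩, 2 * (C + D), fun z => ?_⟩
    · rw [SlashAction.add_slash, hfM γ (Gamma_le_Gamma_of_dvd (dvd_mul_right M N) hγ),
        hgN γ (Gamma_le_Gamma_of_dvd (dvd_mul_left N M) hγ)]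
    · have h1 := hC z
      have h2 := hD z
      rw [norm_petersson] at h1 h2 ⊢
      have hy : 0 < z.im ^ k := zpow_pos z.im_pos k
      have h3 : ‖(f + g) z‖ * ‖(f + g) z‖ ≤ 2 * (‖f z‖ * ‖f z‖ + ‖g z‖ * ‖g z‖) := by
        have h4 : ‖(f + g) z‖ ≤ ‖f z‖ + ‖g z‖ := norm_add_le _ _
        nlinarith [norm_nonneg ((f + g) z), sq_nonneg (‖f z‖ - ‖g z‖)]
      nlinarith [mul_le_mul_of_nonneg_right h3 hy.le]
  smul_mem' := by
    rintro c f ⟨hf, ⟨M, hM, hfM⟩, C, hC⟩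
    refine ⟨hf.const_smul c, ⟨M, hM, fun γ hγ => ?_⟩, ‖c‖ * ‖c‖ * C, fun z => ?_⟩
    · rw [ModularForm.SL_smul_slash, hfM γ hγ]
    · have h1 := mul_le_mul_of_nonneg_left (hC z) (mul_nonneg (norm_nonneg c) (norm_nonneg c))
      rw [norm_petersson] at h1 ⊢
      rw [Pi.smul_apply, norm_smul]
      linarith

variable {f g h : ℍ → ℂ}

lemma petersson_bounded (hf : f ∈ boundedForms k) (hg : g ∈ boundedForms k) :
    ∃ C : ℝ, ∀ z, ‖petersson k f g z‖ ≤ C := by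
  obtain ⟨-, -, C, hC⟩ := hf
  obtain ⟨-, -, D, hD⟩ := hg
  refine ⟨C + D, fun z => ?_⟩
  have h1 := hC z
  have h2 := hD z
  rw [norm_petersson] at h1 h2 ⊢
  have hy : 0 < z.im ^ k := zpow_pos z.im_pos k
  have h3 : ‖f z‖ * ‖g z‖ ≤ ‖f z‖ * ‖f z‖ + ‖g z‖ * ‖g z‖ := by
    nlinarith [sq_nonneg (‖f z‖ - ‖g z‖), norm_nonneg (f z), norm_nonneg (g z)]
  nlinarith [mul_le_mul_of_nonneg_right h3 hy.le]

lemma petersson_measurable (hf : f ∈ boundedForms k) (hg : g ∈ boundedForms k) :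
    Measurable (petersson k f g) :=
  (petersson_continuous k hf.1 hg.1).measurable

lemma petersson_level (hf : f ∈ boundedForms k) (hg : g ∈ boundedForms k) :
    ∃ N ≠ 0, ∀ γ ∈ Gamma N, ∀ z : ℍ, petersson k f g (γ • z) = petersson k f g z := by
  obtain ⟨-, ⟨M, hM, hfM⟩, -⟩ := hf
  obtain ⟨-, ⟨N, hN, hgN⟩, -⟩ := hg
  refine ⟨M * N, mul_ne_zero hM hN, fun γ hγ z => ?_⟩
  rw [← petersson_slash_SL, hfM γ (Gamma_le_Gamma_of_dvd (dvd_mul_right M N) hγ),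
    hgN γ (Gamma_le_Gamma_of_dvd (dvd_mul_left N M) hγ)]

/-- The scalar product of automorphic functions of arbitrary level for the probability measure. -/
def bracket (k : ℤ) (f g : ℍ → ℂ) : ℂ := mean (petersson k f g)

lemma bracket_add_right (hf : f ∈ boundedForms k) (hg : g ∈ boundedForms k)
    (hh : h ∈ boundedForms k) : bracket k f (g + h) = bracket k f g + bracket k f h := by
  rw [bracket, bracket, bracket, ← mean_add (petersson_measurable hf hg)
    (petersson_measurable hf hh) (petersson_bounded hf hg) (petersson_bounded hf hh)
    (petersson_level hf hg) (petersson_level hf hh)]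
  congr 1
  ext z
  simp [petersson]
  ring

lemma bracket_smul_right (c : ℂ) (hf : f ∈ boundedForms k) (hg : g ∈ boundedForms k) :
    bracket k f (c • g) = c * bracket k f g := by
  rw [bracket, bracket, ← mean_const_mul c (petersson_measurable hf hg) (petersson_level hf hg)]
  congr 1
  ext z
  simp [petersson]
  ring

lemma bracket_conj (hf : f ∈ boundedForms k) (hg : g ∈ boundedForms k) :
    conj (bracket k f g) = bracket k g f := by
  rw [bracket, bracket, ← mean_conj (petersson_measurable hf hg) (petersson_level hf hg)]
  congr 1
  ext z
  rw [petersson_symm, Complex.conj_conj]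

lemma bracket_smul_left (c : ℂ) (hf : f ∈ boundedForms k) (hg : g ∈ boundedForms k) :
    bracket k (c • f) g = conj c * bracket k f g := by
  rw [← bracket_conj hg (Submodule.smul_mem _ c hf), bracket_smul_right c hg hf, map_mul,
    bracket_conj hg hf]

lemma bracket_zero_right (hf : f ∈ boundedForms k) : bracket k f 0 = 0 := by
  simpa using bracket_smul_right 0 hf hf

lemma bracket_sum_right {ι : Type*} (s : Finset ι) (F : ι → ℍ → ℂ) (hf : f ∈ boundedForms k)
    (hF : ∀ i ∈ s, F i ∈ boundedForms k) :
    bracket k f (∑ i ∈ s, F i) = ∑ i ∈ s, bracket k f (F i) := by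
  classical
  induction s using Finset.induction_on with
  | empty => simpa using bracket_zero_right hf
  | insert i t hi IH =>
    rw [Finset.forall_mem_insert] at hF
    rw [Finset.sum_insert hi, Finset.sum_insert hi, ← IH hF.2,
      bracket_add_right hf hF.1 (Submodule.sum_mem _ hF.2)]

lemma slash_eq_of_det_pos (f : ℍ → ℂ) {β : GL (Fin 2) ℝ} (hβ : 0 < β.det.val) (z : ℍ) :
    (f ∣[k] β) z = f (β • z) * (β.det.val : ℂ) ^ (k - 1) * denom β z ^ (-k) := by
  rw [ModularForm.slash_apply, σ, if_pos hβ, abs_of_pos hβ]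
  rfl

lemma det_toReal_pos {β : GL (Fin 2) ℚ} (hβ : 0 < β.det.val) : 0 < (toReal β).det.val := by
  have : (toReal β).det.val = ((β.det.val : ℚ) : ℝ) := by
    simp [toReal, Matrix.det_fin_two]
  rw [this]
  exact_mod_cast hβ

lemma petersson_slash_of_det_pos (f g : ℍ → ℂ) {β : GL (Fin 2) ℝ} (hβ : 0 < β.det.val) (z : ℍ) :
    petersson k (f ∣[k] β) (g ∣[k] β) z =
      (β.det.val : ℂ) ^ (k - 2) * petersson k f g (β • z) := by
  rw [petersson_slash, σ, if_pos hβ, abs_of_pos hβ]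
  rfl

lemma slash_mem_boundedForms {β : GL (Fin 2) ℚ} (hβ : 0 < β.det.val) (hf : f ∈ boundedForms k) :
    f ∣[k] toReal β ∈ boundedForms k := by
  obtain ⟨hc, ⟨N, hN, hfN⟩, C, hC⟩ := hf
  have hβ' := det_toReal_pos hβ
  refine ⟨?_, ?_, (toReal β).det.val ^ (k - 2) * C, fun z => ?_⟩
  · have : f ∣[k] toReal β = fun z => f (toReal β • z) * ((toReal β).det.val : ℂ) ^ (k - 1) *
        denom (toReal β) z ^ (-k) := funext fun z => slash_eq_of_det_pos f hβ' z
    rw [this]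
    refine ((hc.comp (continuous_const_smul _)).mul continuous_const).mul ?_
    refine Continuous.zpow₀ ?_ _ fun z => Or.inl (denom_ne_zero _ z)
    unfold denom
    fun_prop
  · have : NeZero N := ⟨hN⟩
    obtain ⟨M, hM, hle⟩ := exists_Gamma_le_conj' β N
    refine ⟨M, hM, fun γ hγ => ?_⟩
    obtain ⟨δ, hδ, e⟩ := hle ⟨mapGL ℝ γ, ⟨γ, hγ, rfl⟩, rfl⟩
    change mapGL ℝ δ = toReal β * mapGL ℝ γ * (toReal β)⁻¹ at e
    rw [ModularForm.SL_slash, ← SlashAction.slash_mul]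
    change f ∣[k] (toReal β * mapGL ℝ γ) = _
    rw [mul_inv_eq_iff_eq_mul.mp e.symm, SlashAction.slash_mul]
    congr 1
    exact hfN δ hδ
  · rw [petersson_slash_of_det_pos f f hβ', norm_mul, norm_zpow, Complex.norm_real,
      Real.norm_of_nonneg hβ'.le]
    exact mul_le_mul_of_nonneg_left (hC _) (zpow_pos hβ' _).le

lemma bracket_slash {β : GL (Fin 2) ℚ} (hβ : 0 < β.det.val) (hf : f ∈ boundedForms k)
    (hg : g ∈ boundedForms k) : bracket k (f ∣[k] toReal β) (g ∣[k] toReal β) =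
      ((toReal β).det.val : ℂ) ^ (k - 2) * bracket k f g := by
  have hlev := petersson_level hf hg
  have hm := petersson_measurable hf hg
  have hsl := petersson_level (slash_mem_boundedForms hβ hf) (slash_mem_boundedForms hβ hg)
  have hne : ((toReal β).det.val : ℂ) ^ (k - 2) ≠ 0 :=
    zpow_ne_zero _ (Complex.ofReal_ne_zero.mpr (det_toReal_pos hβ).ne')
  have e := funext fun z => petersson_slash_of_det_pos (k := k) f g (det_toReal_pos hβ) z
  rw [bracket, bracket, ← mean_comp β hm hlev]
  rw [e] at hsl ⊢
  refine mean_const_mul _ (hm.comp (measurable_const_smul _)) ?_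
  obtain ⟨N, hN, h⟩ := hsl
  -- The level of the translated integrand is read off from the slashed forms by cancelling the
  -- power of the determinant.
  exact ⟨N, hN, fun γ hγ z => mul_left_cancel₀ hne (h γ hγ z)⟩

end Automorphic

/-! ### Sums of translates of cusp forms, and lowering of the level. -/

section CuspForms

open Matrix.SpecialLinearGroup

variable {k N : ℕ}

lemma mem_Gamma0_iff_dvd {γ : SL(2, ℤ)} : γ ∈ Gamma0 N ↔ (N : ℤ) ∣ γ 1 0 := by
  rw [Gamma0_mem, ZMod.intCast_zmod_eq_zero_iff_dvd]

lemma slash_Gamma0 (f : CuspSpace k N) {γ : SL(2, ℤ)} (hγ : γ ∈ Gamma0 N) :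
    (f : ℍ → ℂ) ∣[(k : ℤ)] γ = f :=
  SlashInvariantFormClass.slash_action_eq f _ ⟨γ, hγ, rfl⟩

lemma coe_mem_boundedForms [NeZero N] (f : CuspSpace k N) : (f : ℍ → ℂ) ∈ boundedForms k := by
  refine ⟨ModularFormClass.continuous f, ⟨N, NeZero.ne N, fun γ hγ => slash_Gamma0 f ?_⟩,
    CuspFormClass.petersson_bounded_left k _ f f⟩
  rw [Gamma_mem] at hγ
  exact Gamma0_mem.mpr hγ.2.2.1

/-- The normalised Petersson product is `V` times the scalar product for the probability measure. -/
lemma inner_eq_bracket [NeZero N] (V : ℝ) (f g : CuspSpace k N) :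
    inner V f g = V * bracket k f g := by
  have hf := coe_mem_boundedForms f
  have hg := coe_mem_boundedForms g
  obtain ⟨C, hC⟩ := petersson_bounded hf hg
  have hm := petersson_measurable hf hg
  have h1 : quotientIntegral N (petersson k f g) =
      ∫ z, petersson k f g z ∂cosetMeasure (Gamma0 N) :=
    (integral_cosetMeasure (Gamma0 N) hm hC).symm
  have h2 : quotientIntegral N (fun _ => 1) = ((cosetMeasure (Gamma0 N)).real Set.univ : ℂ) := by
    rw [quotientIntegral, ← integral_cosetMeasure (Gamma0 N) (F := fun _ => (1 : ℂ))
      measurable_const (C := 1) (by simp)]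
    simp
  rw [inner, h1, h2, bracket, mean_eq (Gamma0_is_congruence N) hm, levelMean]
  · ring
  · intro γ hγ z
    rw [← petersson_slash_SL, slash_Gamma0 f hγ, slash_Gamma0 g hγ]

lemma toReal_mapGL (γ : SL(2, ℤ)) : toReal (mapGL ℚ γ) = mapGL ℝ γ := by
  ext i j
  simp [toReal]

lemma slash_toReal_mapGL_mul (f : CuspSpace k N) {γ : SL(2, ℤ)} (hγ : γ ∈ Gamma0 N)
    (g : GL (Fin 2) ℚ) :
    (f : ℍ → ℂ) ∣[(k : ℤ)] toReal (mapGL ℚ γ * g) = (f : ℍ → ℂ) ∣[(k : ℤ)] toReal g := by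
  rw [map_mul, SlashAction.slash_mul, toReal_mapGL]
  congr 1
  exact slash_Gamma0 f hγ

lemma isZeroAt_sum {ι : Type*} (s : Finset ι) {c : OnePoint ℝ} {j : ℤ} {F : ι → ℍ → ℂ}
    (hF : ∀ i ∈ s, c.IsZeroAt (F i) j) : c.IsZeroAt (∑ i ∈ s, F i) j := by
  classical
  induction s using Finset.induction_on with
  | empty =>
    intro g _
    rw [Finset.sum_empty, SlashAction.zero_slash]
    exact Filter.zero_zeroAtFilter _
  | insert i t hi IH =>
    rw [Finset.forall_mem_insert] at hF
    rw [Finset.sum_insert hi]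
    exact hF.1.add (IH hF.2)

/-- The sum of the translates of a cusp form of level `N` by a finite family of rational matrices
is a cusp form of level `N'` if `Γ₀(N')` permutes the cosets `Γ₀(N) gᵢ`. -/
lemma exists_cuspForm_sum_slash [NeZero N] {N' : ℕ} [NeZero N'] {ι : Type} [Fintype ι]
    (f : CuspSpace k N) (g : ι → GL (Fin 2) ℚ)
    (hg : ∀ γ ∈ Gamma0 N', ∃ σ : Equiv.Perm ι, ∀ i, ∃ δ ∈ Gamma0 N,
      g i * mapGL ℚ γ = mapGL ℚ δ * g (σ i)) :
    ∃ ψ : CuspSpace k N', (ψ : ℍ → ℂ) = ∑ i, (f : ℍ → ℂ) ∣[(k : ℤ)] toReal (g i) := by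
  refine ⟨⟨⟨∑ i, (f : ℍ → ℂ) ∣[(k : ℤ)] toReal (g i), ?_⟩, ?_, ?_⟩, rfl⟩
  · rintro _ ⟨γ, hγ, rfl⟩
    obtain ⟨σ, hσ⟩ := hg γ hγ
    rw [SlashAction.sum_slash]
    refine (Finset.sum_congr rfl fun i _ => ?_).trans
      (Equiv.sum_comp σ fun i => (f : ℍ → ℂ) ∣[(k : ℤ)] toReal (g i))
    obtain ⟨δ, hδ, e⟩ := hσ i
    change _ ∣[(k : ℤ)] (mapGL ℝ γ) = _
    rw [← SlashAction.slash_mul, ← toReal_mapGL, ← map_mul, e, slash_toReal_mapGL_mul f hδ]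
  · change MDifferentiable _ _ (∑ i, (f : ℍ → ℂ) ∣[(k : ℤ)] toReal (g i))
    exact MDifferentiable.sum fun i _ => (CuspFormClass.holo f).slash _ _
  · intro c hc
    refine isZeroAt_sum _ fun i _ => ?_
    -- Conjugates of `Γ₀(N)` by rational matrices are arithmetic, and all arithmetic groups have the
    -- cusps of `SL₂(ℤ)`; so each translate vanishes at every cusp in question.
    have harith : (ConjAct.toConjAct (toReal (g i))⁻¹ •
        (Gamma0 N : Subgroup (GL (Fin 2) ℝ))).IsArithmetic := by
      have := Subgroup.IsArithmetic.conj (Gamma0 N : Subgroup (GL (Fin 2) ℝ)) (g i)⁻¹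
      rwa [map_inv] at this
    refine (CuspForm.translate f (toReal (g i))).zero_at_cusps' ?_
    rw [Subgroup.IsArithmetic.isCusp_iff_isCusp_SL2Z] at hc ⊢
    exact hc

/-- The rational matrix with given entries. -/
def ratMat (a b c d : ℚ) (h : a * d - b * c ≠ 0) : GL (Fin 2) ℚ :=
  Matrix.GeneralLinearGroup.mkOfDetNeZero !![a, b; c, d] (by simpa [Matrix.det_fin_two] using h)

/-- The matrix `[1, x; 0, 1]`. -/
def upper (x : ℚ) : GL (Fin 2) ℚ := ratMat 1 x 0 1 (by simp)

/-- The matrix `[1, 0; y, 1]`. -/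
def lower (y : ℚ) : GL (Fin 2) ℚ := ratMat 1 0 y 1 (by simp)

/-- The matrix `[d, 0; 0, 1]`. -/
def scale (d : ℕ) [NeZero d] : GL (Fin 2) ℚ := ratMat d 0 0 1 (by simp [NeZero.ne d])

@[simp] lemma coe_upper (x : ℚ) : (upper x : Matrix (Fin 2) (Fin 2) ℚ) = !![1, x; 0, 1] := rfl

@[simp] lemma coe_lower (y : ℚ) : (lower y : Matrix (Fin 2) (Fin 2) ℚ) = !![1, 0; y, 1] := rfl

@[simp] lemma coe_scale (d : ℕ) [NeZero d] :
    (scale d : Matrix (Fin 2) (Fin 2) ℚ) = !![(d : ℚ), 0; 0, 1] := rfl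

lemma upper_add (x y : ℚ) : upper (x + y) = upper x * upper y := by
  ext i j
  fin_cases i <;> fin_cases j <;> simp [add_comm]

lemma lower_add (x y : ℚ) : lower (x + y) = lower x * lower y := by
  ext i j
  fin_cases i <;> fin_cases j <;> simp

lemma coe_mapGL_rat (γ : SL(2, ℤ)) : (mapGL ℚ γ : Matrix (Fin 2) (Fin 2) ℚ) =
    !![(γ 0 0 : ℚ), (γ 0 1 : ℚ); (γ 1 0 : ℚ), (γ 1 1 : ℚ)] := by
  rw [mapGL_coe_matrix]
  ext i j
  fin_cases i <;> fin_cases j <;> simp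

lemma exists_mapGL_eq {a b c d : ℤ} (h : a * d - b * c = 1) : ∃ δ : SL(2, ℤ), δ 1 0 = c ∧
    (mapGL ℚ δ : Matrix (Fin 2) (Fin 2) ℚ) = !![(a : ℚ), (b : ℚ); (c : ℚ), (d : ℚ)] := by
  let δ : SL(2, ℤ) := ⟨!![a, b; c, d], by rw [Matrix.det_fin_two_of, h]⟩
  exact ⟨δ, rfl, coe_mapGL_rat δ⟩

lemma det_eq_one (γ : SL(2, ℤ)) : γ 0 0 * γ 1 1 - γ 0 1 * γ 1 0 = 1 := by
  have := γ.det_coe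
  rwa [Matrix.det_fin_two] at this

/-- The affine permutation `x ↦ u * (t + x * u)`, for a unit `u` with inverse `v`. -/
def affinePerm {R : Type*} [CommRing R] (u v t : R) (h : v * u = 1) : Equiv.Perm R where
  toFun x := u * (t + x * u)
  invFun x := v * (v * x - t)
  left_inv x := by linear_combination (v * t + x * (v * u + 1)) * h
  right_inv x := by linear_combination (u * t + x * (v * u + 1)) * h - 2 * u * t * h

/-- The average of a form of level `q` over translates by `lower (j M)`, with `q = e M` and `e ∣ M`,
has level `M`. -/
lemma exists_cuspForm_sum_lower {M e : ℕ} [NeZero M] [NeZero e] (heM : e ∣ M)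
    (f : CuspSpace k (e * M)) : ∃ ψ : CuspSpace k M,
      (ψ : ℍ → ℂ) = ∑ j : ZMod e, (f : ℍ → ℂ) ∣[(k : ℤ)] toReal (lower (j.val * M)) := by
  refine exists_cuspForm_sum_slash f _ fun γ hγ => ?_
  obtain ⟨c, hc⟩ := mem_Gamma0_iff_dvd.mp hγ
  obtain ⟨t, ht⟩ := heM
  have hdet := det_eq_one γ
  have hMe : ((M : ℤ) : ZMod e) = 0 := by
    rw [ZMod.intCast_zmod_eq_zero_iff_dvd]
    exact ⟨t, by exact_mod_cast ht⟩
  set a := γ 0 0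
  set b := γ 0 1
  set D := γ 1 1
  rw [hc] at hdet
  have haD : (D : ZMod e) * (a : ZMod e) = 1 := by
    have := congrArg (Int.cast : ℤ → ZMod e) hdet
    push_cast at this hMe
    rw [hMe] at this
    linear_combination this
  -- With `γ 1 0 = M c`, the quotient of `lower (j M) * γ` by `lower (j' M)` lies in `Γ₀(e M)`
  -- exactly when `j' D ≡ j a + c` mod `e`, since `e ∣ M`; and `a` inverts `D` mod `e`.
  refine ⟨affinePerm (a : ZMod e) D c haD, fun j => ?_⟩
  set j' : ZMod e := affinePerm (a : ZMod e) D c haD j with hj'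
  obtain ⟨s, hs⟩ : (e : ℤ) ∣ j.val * a + c - j'.val * (D + j.val * M * b) := by
    rw [← ZMod.intCast_zmod_eq_zero_iff_dvd]
    push_cast at hMe ⊢
    rw [ZMod.natCast_zmod_val, ZMod.natCast_zmod_val, hMe, hj']
    simp only [affinePerm, Equiv.coe_fn_mk]
    linear_combination (-(c + j * a) : ZMod e) * haD
  obtain ⟨δ, hδ, e'⟩ := exists_mapGL_eq (a := a - b * (j'.val * M)) (b := b)
    (c := M * (e * s)) (d := D + j.val * M * b) (by
      rw [← hs]
      linear_combination hdet)
  refine ⟨δ, mem_Gamma0_iff_dvd.mpr ⟨s, by rw [hδ]; push_cast; ring⟩, ?_⟩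
  have hsq : ((e : ℚ) * s) = j.val * a + c - j'.val * (D + j.val * M * b) := by
    exact_mod_cast hs.symm
  apply Units.ext
  rw [Units.val_mul, Units.val_mul, e', coe_mapGL_rat, coe_lower, coe_lower, hc]
  push_cast
  rw [hsq]
  ext i l
  fin_cases i <;> fin_cases l <;> simp [Matrix.mul_apply, Fin.sum_univ_two] <;> ring

/-- The sum of a form of level `d M`, with `d ∣ M`, over translates by `upper (i / d)` is the
dilation by `d` of a form of level `M`. -/
lemma exists_cuspForm_sum_upper {M d : ℕ} [NeZero M] [NeZero d] (hdM : d ∣ M)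
    (f : CuspSpace k (d * M)) : ∃ ψ : CuspSpace k M,
      (ψ : ℍ → ℂ) ∣[(k : ℤ)] toReal (scale d) =
        ∑ i : ZMod d, (f : ℍ → ℂ) ∣[(k : ℤ)] toReal (upper (i.val / d)) := by
  have hd : (d : ℚ) ≠ 0 := by exact_mod_cast NeZero.ne d
  have hperm : ∀ γ ∈ Gamma0 M, ∃ σ : Equiv.Perm (ZMod d), ∀ i, ∃ δ ∈ Gamma0 (d * M),
      upper (i.val / d) * (scale d)⁻¹ * mapGL ℚ γ =
        mapGL ℚ δ * (upper ((σ i).val / d) * (scale d)⁻¹) := by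
    intro γ hγ
    obtain ⟨c₁, hc₁⟩ := mem_Gamma0_iff_dvd.mp hγ
    obtain ⟨t, ht⟩ := hdM
    have hdet := det_eq_one γ
    set a := γ 0 0
    set b := γ 0 1
    set D := γ 1 1
    set c := γ 1 0
    have hcd : ((c : ℤ) : ZMod d) = 0 := by
      rw [ZMod.intCast_zmod_eq_zero_iff_dvd, hc₁, ht]
      exact ⟨t * c₁, by push_cast; ring⟩
    have haD : (a : ZMod d) * (D : ZMod d) = 1 := by
      have := congrArg (Int.cast : ℤ → ZMod d) hdet
      push_cast at this
      rw [hcd] at this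
      linear_combination this
    -- Here the upper right entry of `δ` must be integral, which means `i' a ≡ b + i D` mod `d`,
    -- since `d ∣ c`; and `D` inverts `a` mod `d`.
    refine ⟨affinePerm (D : ZMod d) a b haD, fun i => ?_⟩
    set i' : ZMod d := affinePerm (D : ZMod d) a b haD i with hi'
    obtain ⟨s, hs⟩ : (d : ℤ) ∣ b + i.val * D - i'.val * (a + i.val * c) := by
      rw [← ZMod.intCast_zmod_eq_zero_iff_dvd]
      push_cast
      rw [ZMod.natCast_zmod_val, ZMod.natCast_zmod_val, hcd, hi']
      simp only [affinePerm, Equiv.coe_fn_mk]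
      linear_combination (-(b + i * D) : ZMod d) * haD
    obtain ⟨δ, hδ, e'⟩ := exists_mapGL_eq (a := a + i.val * c) (b := s)
      (c := d * c) (d := D - i'.val * c) (by
        linear_combination hdet + c * hs)
    refine ⟨δ, mem_Gamma0_iff_dvd.mpr ⟨c₁, by rw [hδ, hc₁]; push_cast; ring⟩, ?_⟩
    have hsq : (d : ℚ) * s = b + i.val * D - i'.val * (a + i.val * c) := by
      exact_mod_cast hs.symm
    have key : upper (i.val / d) * (scale d)⁻¹ * mapGL ℚ γ * scale d =
        mapGL ℚ δ * upper (i'.val / d) := by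
      have hinv : (scale d)⁻¹ = ratMat (1 / d) 0 0 1 (by simpa using hd) := by
        rw [inv_eq_iff_mul_eq_one]
        ext l m
        fin_cases l <;> fin_cases m <;> simp [ratMat, hd]
      rw [hinv]
      apply Units.ext
      have hr : (ratMat (1 / d) 0 0 1 (by simpa using hd) : Matrix (Fin 2) (Fin 2) ℚ) =
        !![1 / (d : ℚ), 0; 0, 1] := rfl
      have hs' : (s : ℚ) = (b + i.val * D - i'.val * (a + i.val * c)) / d := by
        rw [← hsq]; field_simp
      simp only [Units.val_mul]
      rw [e', coe_mapGL_rat, coe_upper, coe_upper, coe_scale, hr]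
      push_cast
      rw [hs']
      ext l m
      fin_cases l <;> fin_cases m <;> simp [Matrix.mul_apply, Fin.sum_univ_two] <;> field_simp <;>
        ring
    rw [← mul_assoc, ← key, mul_inv_cancel_right]
  obtain ⟨ψ, hψ⟩ := exists_cuspForm_sum_slash f
    (fun i : ZMod d => upper (i.val / d) * (scale d)⁻¹) hperm
  refine ⟨ψ, ?_⟩
  rw [hψ, SlashAction.sum_slash]
  refine Finset.sum_congr rfl fun i _ => ?_
  rw [← SlashAction.slash_mul, ← map_mul, inv_mul_cancel_right]

end CuspForms

/-! ### Dilations: isometry, invariance under translations, Fourier coefficients. -/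

section Dilation

open Matrix.SpecialLinearGroup

variable {k N : ℕ}

lemma det_upper (x : ℚ) : (upper x).det.val = 1 := by
  simp [Matrix.det_fin_two]

lemma det_lower (y : ℚ) : (lower y).det.val = 1 := by
  simp [Matrix.det_fin_two]

lemma det_scale (d : ℕ) [NeZero d] : (scale d).det.val = d := by
  simp [Matrix.det_fin_two]

lemma det_scale_pos (d : ℕ) [NeZero d] : 0 < (scale d).det.val := by
  rw [det_scale]
  exact_mod_cast Nat.pos_of_ne_zero (NeZero.ne d)

lemma det_toReal (β : GL (Fin 2) ℚ) : (toReal β).det.val = ((β.det.val : ℚ) : ℝ) := by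
  simp [toReal, Matrix.det_fin_two]

/-- The constant relating `dilate d` to the slash action of `scale d`. -/
def dilateConst (k d : ℕ) : ℝ := (d : ℝ) ^ ((k : ℝ) / 2) / (d : ℝ) ^ ((k : ℤ) - 1)

lemma dilateConst_ne_zero (d : ℕ) [NeZero d] : dilateConst k d ≠ 0 := by
  have hd : 0 < (d : ℝ) := by exact_mod_cast Nat.pos_of_ne_zero (NeZero.ne d)
  exact (div_pos (Real.rpow_pos_of_pos hd _) (zpow_pos hd _)).ne'

/-- Slashing by `scale d` multiplies the scalar product by `d ^ (k - 2)`; this identity is what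
makes `dilate d` an isometry. -/
lemma dilateConst_sq (d : ℕ) [NeZero d] :
    dilateConst k d * dilateConst k d * (d : ℝ) ^ ((k : ℤ) - 2) = 1 := by
  have hd : 0 < (d : ℝ) := by exact_mod_cast Nat.pos_of_ne_zero (NeZero.ne d)
  have h1 : (d : ℝ) ^ ((k : ℝ) / 2) * (d : ℝ) ^ ((k : ℝ) / 2) = (d : ℝ) ^ (k : ℤ) := by
    rw [← Real.rpow_add hd, add_halves, zpow_natCast, Real.rpow_natCast]
  have h2 : (d : ℝ) ^ ((k : ℤ) - 1) * (d : ℝ) ^ ((k : ℤ) - 1) =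
      (d : ℝ) ^ (k : ℤ) * (d : ℝ) ^ ((k : ℤ) - 2) := by
    rw [← zpow_add₀ hd.ne', ← zpow_add₀ hd.ne']
    congr 1
    ring
  have h3 := (zpow_pos hd ((k : ℤ) - 1)).ne'
  rw [dilateConst, div_mul_div_comm, h1, div_mul_eq_mul_div, ← h2, div_self (mul_ne_zero h3 h3)]

lemma scale_smul (d : ℕ) [NeZero d] (z : ℍ) :
    toReal (scale d) • z = ofComplex ((d : ℂ) * (z : ℂ)) := by
  have hd : 0 < (d : ℝ) := by exact_mod_cast Nat.pos_of_ne_zero (NeZero.ne d)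
  have him : 0 < ((d : ℂ) * (z : ℂ)).im := by
    simpa using mul_pos hd z.im_pos
  apply UpperHalfPlane.ext
  rw [ofComplex_apply_of_im_pos him, coe_smul_of_det_pos (det_toReal_pos (det_scale_pos d))]
  simp [num, denom, toReal]

lemma dilate_eq_slash (d : ℕ) [NeZero d] (φ : CuspSpace k N) :
    dilate d φ = (dilateConst k d : ℂ) • ((φ : ℍ → ℂ) ∣[(k : ℤ)] toReal (scale d)) := by
  ext z
  have hd : (d : ℂ) ≠ 0 := by exact_mod_cast NeZero.ne d
  have hden : denom (toReal (scale d)) z = 1 := by simp [denom, toReal]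
  rw [Pi.smul_apply, slash_eq_of_det_pos _ (det_toReal_pos (det_scale_pos d)), hden, one_zpow,
    mul_one, det_toReal, det_scale, scale_smul, dilate, dilateConst, smul_eq_mul]
  push_cast
  have := zpow_ne_zero ((k : ℤ) - 1) hd
  field_simp

lemma dilate_smul (d : ℕ) (c : ℂ) (φ : CuspSpace k N) : dilate d (c • φ) = c • dilate d φ := by
  ext z
  simp only [dilate, Pi.smul_apply, smul_eq_mul]
  change _ * (c * φ _) = _
  ring

lemma dilate_mem_boundedForms [NeZero N] (d : ℕ) [NeZero d] (φ : CuspSpace k N) :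
    dilate d φ ∈ boundedForms k := by
  rw [dilate_eq_slash]
  exact Submodule.smul_mem _ _ (slash_mem_boundedForms (det_scale_pos d) (coe_mem_boundedForms φ))

lemma bracket_dilate [NeZero N] (d : ℕ) [NeZero d] (φ ψ : CuspSpace k N) :
    bracket k (dilate d φ) (dilate d ψ) = bracket k φ ψ := by
  have hφ := slash_mem_boundedForms (det_scale_pos d) (coe_mem_boundedForms φ)
  have hψ := slash_mem_boundedForms (det_scale_pos d) (coe_mem_boundedForms ψ)
  rw [dilate_eq_slash, dilate_eq_slash, bracket_smul_right _ (Submodule.smul_mem _ _ hφ) hψ,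
    bracket_smul_left _ hφ hψ, bracket_slash (det_scale_pos d) (coe_mem_boundedForms φ)
      (coe_mem_boundedForms ψ), Complex.conj_ofReal, ← mul_assoc, ← mul_assoc, det_toReal,
    det_scale]
  have := congrArg (fun x : ℝ => (x : ℂ)) (dilateConst_sq (k := k) d)
  push_cast at this ⊢
  rw [this, one_mul]

lemma slash_upper_int (φ : CuspSpace k N) (n : ℤ) :
    (φ : ℍ → ℂ) ∣[(k : ℤ)] toReal (upper n) = φ := by
  obtain ⟨δ, hδ, e⟩ := exists_mapGL_eq (a := 1) (b := n) (c := 0) (d := 1) (by ring)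
  have h : upper n = mapGL ℚ δ * 1 := by
    rw [mul_one]
    apply Units.ext
    rw [e, coe_upper]
    simp
  rw [h, slash_toReal_mapGL_mul φ (mem_Gamma0_iff_dvd.mpr (by simp [hδ])), map_one,
    SlashAction.slash_one]

lemma slash_lower_mul (φ : CuspSpace k N) (n : ℤ) :
    (φ : ℍ → ℂ) ∣[(k : ℤ)] toReal (lower (n * N)) = φ := by
  obtain ⟨δ, hδ, e⟩ := exists_mapGL_eq (a := 1) (b := 0) (c := n * N) (d := 1) (by ring)
  have h : lower (n * N) = mapGL ℚ δ * 1 := by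
    rw [mul_one]
    apply Units.ext
    rw [e, coe_lower]
    simp
  rw [h, slash_toReal_mapGL_mul φ (mem_Gamma0_iff_dvd.mpr (by simp [hδ])), map_one,
    SlashAction.slash_one]

lemma smul_slash_toReal {β : GL (Fin 2) ℚ} (hβ : 0 < β.det.val) (c : ℂ) (f : ℍ → ℂ) :
    (c • f) ∣[(k : ℤ)] toReal β = c • (f ∣[(k : ℤ)] toReal β) := by
  rw [ModularForm.smul_slash, σ, if_pos (det_toReal_pos hβ)]
  rfl

lemma dilate_slash_upper (d : ℕ) [NeZero d] (φ : CuspSpace k N) {x : ℚ} {n : ℤ} (h : d * x = n) :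
    dilate d φ ∣[(k : ℤ)] toReal (upper x) = dilate d φ := by
  -- Moving the translation past the dilation makes it integral, and then it fixes `φ`.
  have hm : scale d * upper x = upper n * scale d := by
    rw [← h]
    ext i j
    fin_cases i <;> fin_cases j <;> simp
  rw [dilate_eq_slash, smul_slash_toReal (by rw [det_upper]; exact one_pos),
    ← SlashAction.slash_mul, ← map_mul, hm, map_mul, SlashAction.slash_mul, slash_upper_int]

lemma dilate_slash_lower (d : ℕ) [NeZero d] (φ : CuspSpace k N) {y : ℚ} {n : ℤ}
    (h : y = d * (n * N)) : dilate d φ ∣[(k : ℤ)] toReal (lower y) = dilate d φ := by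
  have hm : scale d * lower y = lower (n * N) * scale d := by
    rw [h]
    ext i j
    fin_cases i <;> fin_cases j <;> simp [mul_comm]
  rw [dilate_eq_slash, smul_slash_toReal (by rw [det_lower]; exact one_pos),
    ← SlashAction.slash_mul, ← map_mul, hm, map_mul, SlashAction.slash_mul, slash_lower_mul]

lemma exists_cuspForm_dilate [NeZero N] {q d : ℕ} [NeZero q] [NeZero d] (h : d * N ∣ q)
    (φ : CuspSpace k N) : ∃ ψ : CuspSpace k q, (ψ : ℍ → ℂ) = dilate d φ := by
  obtain ⟨t, ht⟩ := h
  obtain ⟨ψ, hψ⟩ := exists_cuspForm_sum_slash (N' := q) φ (fun _ : Unit => scale d) (by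
    intro γ hγ
    refine ⟨Equiv.refl _, fun _ => ?_⟩
    obtain ⟨c, hc⟩ := mem_Gamma0_iff_dvd.mp hγ
    have hdet := det_eq_one γ
    obtain ⟨δ, hδ, e⟩ := exists_mapGL_eq (a := γ 0 0) (b := d * γ 0 1) (c := N * (t * c))
      (d := γ 1 1) (by
        rw [hc, ht] at hdet
        push_cast at hdet
        linear_combination hdet)
    refine ⟨δ, mem_Gamma0_iff_dvd.mpr ⟨t * c, hδ⟩, ?_⟩
    apply Units.ext
    rw [Units.val_mul, Units.val_mul, e, coe_mapGL_rat, coe_scale, hc, ht]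
    push_cast
    ext i j
    fin_cases i <;> fin_cases j <;> simp <;> ring)
  refine ⟨(dilateConst k d : ℂ) • ψ, ?_⟩
  rw [dilate_eq_slash]
  change (dilateConst k d : ℂ) • (ψ : ℍ → ℂ) = _
  rw [hψ]
  simp

lemma qParam_ofComplex_mul (d : ℕ) [NeZero d] (z : ℍ) :
    Function.Periodic.qParam 1 (ofComplex ((d : ℂ) * (z : ℂ)) : ℍ) =
      Function.Periodic.qParam 1 (z : ℂ) ^ d := by
  have hd : 0 < (d : ℝ) := by exact_mod_cast Nat.pos_of_ne_zero (NeZero.ne d)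
  have him : 0 < ((d : ℂ) * (z : ℂ)).im := by
    simpa using mul_pos hd z.im_pos
  rw [ofComplex_apply_of_im_pos him, Function.Periodic.qParam, Function.Periodic.qParam,
    ← Complex.exp_nat_mul]
  congr 1
  simp
  ring

lemma qExpansion_coeff_dilate [NeZero N] {q d : ℕ} [NeZero q] [NeZero d] (φ : CuspSpace k N)
    (ψ : CuspSpace k q) (h : (ψ : ℍ → ℂ) = dilate d φ) (m : ℕ) :
    (qExpansion 1 ψ).coeff m = if d ∣ m then
      (((d : ℝ) ^ ((k : ℝ) / 2) : ℝ) : ℂ) * (qExpansion 1 φ).coeff (m / d) else 0 := by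
  have hd : 0 < d := Nat.pos_of_ne_zero (NeZero.ne d)
  refine (ModularFormClass.qExpansion_coeff_unique (f := ψ) (c := fun m => if d ∣ m then
      (((d : ℝ) ^ ((k : ℝ) / 2) : ℝ) : ℂ) * (qExpansion 1 φ).coeff (m / d) else 0)
    one_pos (by simp) (fun z => ?_) m).symm
  have hsum := ModularForm.hasSum_qExpansion (f := φ) one_pos (by simp)
    (ofComplex ((d : ℂ) * (z : ℂ)))
  rw [congrFun h z, dilate]
  have hinj : Function.Injective (fun m : ℕ => d * m) := fun a b hab =>
    Nat.eq_of_mul_eq_mul_left hd hab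
  rw [← hinj.hasSum_iff]
  · refine (hsum.mul_left (((d : ℝ) ^ ((k : ℝ) / 2) : ℝ) : ℂ)).congr_fun fun m => ?_
    simp only [Function.comp_apply, dvd_mul_right, if_true, Nat.mul_div_cancel_left _ hd,
      smul_eq_mul, qParam_ofComplex_mul]
    ring
  · intro m hm
    have : ¬ d ∣ m := fun ⟨t, ht⟩ => hm ⟨t, ht.symm⟩
    simp [this]

/-- The factor `d ^ (k / 2)` of the dilation is absorbed by the normalisation `m ^ (k / 2)` of the
coefficients. -/
lemma rho_dilate [NeZero N] {q d : ℕ} [NeZero q] [NeZero d] (φ : CuspSpace k N)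
    (ψ : CuspSpace k q) (h : (ψ : ℍ → ℂ) = dilate d φ) (m : ℕ) :
    rho m ψ = if d ∣ m then rho (m / d) φ else 0 := by
  rw [rho, qExpansion_coeff_dilate φ ψ h]
  split_ifs with hdm
  · obtain ⟨t, rfl⟩ := hdm
    have hd : 0 < d := Nat.pos_of_ne_zero (NeZero.ne d)
    have hd' : (0 : ℝ) < d := by exact_mod_cast hd
    rw [rho, Nat.mul_div_cancel_left _ hd, Nat.cast_mul,
      Real.mul_rpow hd'.le (Nat.cast_nonneg t)]
    push_cast
    rw [mul_div_mul_left]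
    exact Complex.ofReal_ne_zero.mpr (Real.rpow_pos_of_pos hd' _).ne'
  · simp

lemma rho_add [NeZero N] (m : ℕ) (f g : CuspSpace k N) : rho m (f + g) = rho m f + rho m g := by
  have h := ModularForm.qExpansion_add (h := 1) one_pos (by simp) f g
  rw [rho, FunLike.coe_add, h, map_add, add_div]
  rfl

lemma rho_smul [NeZero N] (m : ℕ) (c : ℂ) (f : CuspSpace k N) : rho m (c • f) = c * rho m f := by
  have h := ModularForm.qExpansion_smul (h := 1) one_pos (by simp) c f
  rw [rho, FunLike.coe_smul, h, PowerSeries.coeff_smul, smul_eq_mul, mul_div_assoc]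
  rfl

/-- The Fourier coefficient as a linear functional. -/
def rhoHom [NeZero N] (m : ℕ) : CuspSpace k N →ₗ[ℂ] ℂ where
  toFun := rho m
  map_add' := rho_add m
  map_smul' := rho_smul m

end Dilation

/-! ### The averaging operators and their pairings with oldforms. -/

section Projections

open Matrix.SpecialLinearGroup

variable {k q : ℕ}

/-- For `u = i / d` and `v = j q / e` the commutator of `upper u` and `lower v` is `[1 + uv + (uv)²,
-u²v; uv², 1 - uv]`. The two divisibilities make it integral with lower left entry divisible by `q`,
so it lies in `Γ₀(q)`. -/
lemma slash_lower_upper_comm (f : CuspSpace k q) {d e : ℕ} [NeZero d] [NeZero e]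
    (h₁ : d ^ 2 * e ∣ q) (h₂ : d * e ^ 2 ∣ q) (i j : ℤ) :
    (f : ℍ → ℂ) ∣[(k : ℤ)] toReal (lower (j * (q / e)) * upper (i / d)) =
      (f : ℍ → ℂ) ∣[(k : ℤ)] toReal (upper (i / d) * lower (j * (q / e))) := by
  obtain ⟨s, hs⟩ := h₁
  obtain ⟨t, ht⟩ := h₂
  have hd : (d : ℚ) ≠ 0 := by exact_mod_cast NeZero.ne d
  have he : (e : ℚ) ≠ 0 := by exact_mod_cast NeZero.ne e
  have hsq : (q : ℚ) = d ^ 2 * e * s := by exact_mod_cast hs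
  have htq : (q : ℚ) = d * e ^ 2 * t := by exact_mod_cast ht
  have hst : (d * s : ℤ) = e * t := by
    have : ((d * s : ℤ) : ℚ) = ((e * t : ℤ) : ℚ) := by
      push_cast
      have hde := mul_ne_zero hd he
      apply mul_left_cancel₀ hde
      linear_combination htq - hsq
    exact_mod_cast this
  obtain ⟨δ, hδ, e'⟩ := exists_mapGL_eq
    (a := 1 + i * j * (d * s) + (i * j * (d * s)) ^ 2) (b := -(i ^ 2 * j * s))
    (c := i * j ^ 2 * t * q) (d := 1 - i * j * (d * s)) (by
      have hq' : (q : ℤ) = d ^ 2 * e * s := by exact_mod_cast hs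
      rw [hq']
      linear_combination (-(i ^ 3 * j ^ 3 * s ^ 2 * d ^ 2)) * hst)
  have hm : upper (i / d) * lower (j * (q / e)) =
      mapGL ℚ δ * (lower (j * (q / e)) * upper (i / d)) := by
    apply Units.ext
    simp only [Units.val_mul]
    rw [e', coe_upper, coe_lower]
    have hst' : (t : ℚ) = d * s / e := by
      rw [eq_div_iff he]
      have : ((d * s : ℤ) : ℚ) = ((e * t : ℤ) : ℚ) := by rw [hst]
      push_cast at this
      linarith
    push_cast
    rw [hst', hsq]
    ext l m
    fin_cases l <;> fin_cases m <;> simp [Matrix.mul_apply, Fin.sum_univ_two] <;> field_simp <;>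
      ring
  rw [hm, slash_toReal_mapGL_mul f (mem_Gamma0_iff_dvd.mpr ⟨i * j ^ 2 * t, by rw [hδ]; ring⟩)]

/-- The average of the translates of `f` by `lower (j q / e) * upper (i / d)`. -/
def average (q d e k : ℕ) [NeZero d] [NeZero e] (f : ℍ → ℂ) : ℍ → ℂ :=
  ((d : ℂ) * e)⁻¹ • ∑ i : ZMod d, ∑ j : ZMod e,
    f ∣[(k : ℤ)] toReal (lower (j.val * (q / e)) * upper (i.val / d))

lemma det_lower_mul_upper (x y : ℚ) : (lower y * upper x).det.val = 1 := by
  rw [map_mul, Units.val_mul, det_lower, det_upper, one_mul]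

lemma det_upper_mul_lower (x y : ℚ) : (upper x * lower y).det.val = 1 := by
  rw [map_mul, Units.val_mul, det_lower, det_upper, one_mul]

lemma slash_mem_of_det_one {β : GL (Fin 2) ℚ} (hβ : β.det.val = 1) {f : ℍ → ℂ}
    (hf : f ∈ boundedForms k) : f ∣[(k : ℤ)] toReal β ∈ boundedForms k :=
  slash_mem_boundedForms (by rw [hβ]; exact one_pos) hf

lemma bracket_slash_right {β : GL (Fin 2) ℚ} (hβ : β.det.val = 1) {f g : ℍ → ℂ}
    (hf : f ∈ boundedForms k) (hg : g ∈ boundedForms k) (hinv : g ∣[(k : ℤ)] toReal β = g) :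
    bracket k g (f ∣[(k : ℤ)] toReal β) = bracket k g f := by
  conv_lhs => rw [← hinv]
  rw [bracket_slash (by rw [hβ]; exact one_pos) hg hf, det_toReal, hβ]
  simp

variable [NeZero q]

lemma bracket_average (d e : ℕ) [NeZero d] [NeZero e] (f : CuspSpace k q) {g : ℍ → ℂ}
    (hg : g ∈ boundedForms k) :
    bracket k g (average q d e k f) = ((d : ℂ) * e)⁻¹ * ∑ i : ZMod d, ∑ j : ZMod e,
      bracket k g ((f : ℍ → ℂ) ∣[(k : ℤ)] toReal (lower (j.val * (q / e)) * upper (i.val / d))) := by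
  have hm (x y : ℚ) : (f : ℍ → ℂ) ∣[(k : ℤ)] toReal (lower y * upper x) ∈ boundedForms k :=
    slash_mem_of_det_one (det_lower_mul_upper x y) (coe_mem_boundedForms f)
  rw [average, bracket_smul_right _ hg
    (Submodule.sum_mem _ fun i _ => Submodule.sum_mem _ fun j _ => hm _ _),
    bracket_sum_right _ _ hg fun i _ => Submodule.sum_mem _ fun j _ => hm _ _]
  congr 1
  refine Finset.sum_congr rfl fun i _ => ?_
  rw [bracket_sum_right _ _ hg fun j _ => hm _ _]

/-- Averaging is symmetric against dilations of forms of level `M`, where `q = e d M`. -/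
lemma bracket_dilate_average {d e M : ℕ} [NeZero d] [NeZero e] [NeZero M] (hq : q = e * (d * M))
    (f : CuspSpace k q) (φ : CuspSpace k M) :
    bracket k (dilate d φ) (average q d e k f) = bracket k (dilate d φ) f := by
  have hd : (d : ℂ) ≠ 0 := by exact_mod_cast NeZero.ne d
  have he : (e : ℂ) ≠ 0 := by exact_mod_cast NeZero.ne e
  have hdq : (d : ℚ) ≠ 0 := by exact_mod_cast NeZero.ne d
  have heq : (e : ℚ) ≠ 0 := by exact_mod_cast NeZero.ne e
  have hφ := dilate_mem_boundedForms d φ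
  have hterm (i : ZMod d) (j : ZMod e) : bracket k (dilate d φ) ((f : ℍ → ℂ) ∣[(k : ℤ)]
      toReal (lower (j.val * (q / e)) * upper (i.val / d))) = bracket k (dilate d φ) f := by
    refine bracket_slash_right (det_lower_mul_upper _ _) (coe_mem_boundedForms f) hφ ?_
    rw [map_mul, SlashAction.slash_mul, dilate_slash_lower (n := j.val) d φ,
      dilate_slash_upper (n := i.val) d φ]
    · push_cast
      field_simp
    · rw [hq]
      push_cast
      field_simp
  rw [bracket_average d e f hφ]
  simp only [hterm, Finset.sum_const, Finset.card_univ, ZMod.card, nsmul_eq_mul]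
  field_simp

/-- The average is the dilation of a form of level `M`, where `q = e d M`. -/
lemma exists_dilate_eq_average {d e M : ℕ} [NeZero d] [NeZero e] [NeZero M]
    (hq : q = e * (d * M)) (hd : d ∣ M) (he : e ∣ d * M) (f : CuspSpace k q) :
    ∃ ψ : CuspSpace k M, dilate d ψ = average q d e k f := by
  subst hq
  -- The `lower` translates bring the level from `e d M` to `d M`; the `upper` translates then give
  -- a dilated form of level `M`.
  obtain ⟨f₁, hf₁⟩ := exists_cuspForm_sum_lower he f
  obtain ⟨ψ, hψ⟩ := exists_cuspForm_sum_upper hd f₁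
  have hc : (dilateConst k d : ℂ) ≠ 0 := Complex.ofReal_ne_zero.mpr (dilateConst_ne_zero d)
  have heq : (e : ℚ) ≠ 0 := by exact_mod_cast NeZero.ne e
  refine ⟨((d : ℂ) * e)⁻¹ • (dilateConst k d : ℂ)⁻¹ • ψ, ?_⟩
  rw [dilate_smul, dilate_smul, dilate_eq_slash, smul_smul (dilateConst k d : ℂ)⁻¹,
    inv_mul_cancel₀ hc, one_smul, hψ, average]
  congr 1
  refine Finset.sum_congr rfl fun i _ => ?_
  rw [hf₁, SlashAction.sum_slash]
  refine Finset.sum_congr rfl fun j _ => ?_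
  rw [← SlashAction.slash_mul, ← map_mul]
  congr 4
  push_cast
  field_simp

lemma sum_zmod_val (n : ℕ) [NeZero n] (v : ℕ → ℂ) :
    ∑ i : ZMod n, v i.val = ∑ i ∈ Finset.range n, v i := by
  refine Finset.sum_nbij' ZMod.val (fun i => (i : ZMod n)) ?_ ?_ ?_ ?_ ?_
  · exact fun i _ => Finset.mem_range.mpr i.val_lt
  · simp
  · simp
  · exact fun i hi => ZMod.val_natCast_of_lt (Finset.mem_range.mp hi)
  · simp

/-- The sum of a `d`-periodic function over `ℤ/pdℤ`, when `p` and `d` are coprime. -/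
lemma sum_zmod_mul_of_periodic {p d : ℕ} [NeZero d] [NeZero (p * d)] (hpd : p.Coprime d)
    {v : ℕ → ℂ} (hv : Function.Periodic v d) :
    ∑ i : ZMod (p * d), v i.val = p * ∑ i : ZMod d, v (p * i.val) := by
  have h1 : ∀ m : ℕ, ∑ i ∈ Finset.range (m * d), v i = m * ∑ i ∈ Finset.range d, v i := by
    intro m
    induction m with
    | zero => simp
    | succ m ih =>
      rw [Nat.succ_mul, Finset.sum_range_add, ih]
      have : ∀ x, v (m * d + x) = v x := fun x => by
        rw [add_comm]
        exact hv.nat_mul m x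
      simp only [this]
      push_cast
      ring
  rw [sum_zmod_val, h1, ← sum_zmod_val]
  congr 1
  rw [← Equiv.sum_comp (Units.mulLeft (ZMod.unitOfCoprime p hpd))]
  refine Finset.sum_congr rfl fun i _ => ?_
  have : ((Units.mulLeft (ZMod.unitOfCoprime p hpd)) i).val = (p * i.val) % d := by
    rw [Units.mulLeft_apply, ZMod.coe_unitOfCoprime, ZMod.val_mul, ZMod.val_natCast,
      Nat.mul_mod (p % d), Nat.mod_mod, ← Nat.mul_mod]
  rw [this, hv.map_mod_nat]

/-- Since `g` is fixed by `upper (1 / p)`, the pairing with the translate by `upper (i / (p d))`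
depends only on `i` mod `d`. As `p` is invertible mod `d`, `i` may be replaced by `p i`, which gives
the translate by `upper (i / d)`. -/
lemma bracket_average_mul_left {p d e : ℕ} [NeZero p] [NeZero d] [NeZero (p * d)] [NeZero e]
    (hpd : p.Coprime d)
    (f : CuspSpace k q) {g : ℍ → ℂ} (hg : g ∈ boundedForms k)
    (hinv : g ∣[(k : ℤ)] toReal (upper (1 / p)) = g) :
    bracket k g (average q (p * d) e k f) = bracket k g (average q d e k f) := by
  have hd : (d : ℂ) ≠ 0 := by exact_mod_cast NeZero.ne d
  have hp : (p : ℂ) ≠ 0 := by exact_mod_cast NeZero.ne p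
  have he : (e : ℂ) ≠ 0 := by exact_mod_cast NeZero.ne e
  have hdq : (d : ℚ) ≠ 0 := by exact_mod_cast NeZero.ne d
  have hpq : (p : ℚ) ≠ 0 := by exact_mod_cast NeZero.ne p
  let v : ℕ → ℂ := fun i => ∑ j : ZMod e, bracket k g
    ((f : ℍ → ℂ) ∣[(k : ℤ)] toReal (lower (j.val * (q / e)) * upper (i / (p * d))))
  have hv : Function.Periodic v d := by
    intro i
    refine Finset.sum_congr rfl fun j _ => ?_
    have h : ((i + d : ℕ) : ℚ) / (p * d) = i / (p * d) + 1 / p := by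
      push_cast
      field_simp
    rw [h, upper_add, ← mul_assoc, map_mul, SlashAction.slash_mul]
    exact bracket_slash_right (det_upper _) (slash_mem_of_det_one (det_lower_mul_upper _ _)
      (coe_mem_boundedForms f)) hg hinv
  have key := sum_zmod_mul_of_periodic hpd hv
  rw [bracket_average _ _ f hg, bracket_average _ _ f hg]
  have e1 : ∑ i : ZMod (p * d), ∑ j : ZMod e, bracket k g ((f : ℍ → ℂ) ∣[(k : ℤ)]
      toReal (lower (j.val * (q / e)) * upper (i.val / (p * d : ℕ)))) =
        ∑ i : ZMod (p * d), v i.val := by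
    simp only [v, Nat.cast_mul]
  have e2 : ∑ i : ZMod d, ∑ j : ZMod e, bracket k g ((f : ℍ → ℂ) ∣[(k : ℤ)]
      toReal (lower (j.val * (q / e)) * upper (i.val / d))) =
        ∑ i : ZMod d, v (p * i.val) := by
    refine Finset.sum_congr rfl fun i _ => Finset.sum_congr rfl fun j _ => ?_
    congr 5
    push_cast
    field_simp
  rw [e1, e2, key]
  push_cast
  field_simp

/-- The same argument with `lower`. In the average `lower` stands to the left of `upper`, so the two
must first be commuted before the invariance of `g` can be applied. -/
lemma bracket_average_mul_right {p d e : ℕ} [NeZero p] [NeZero d] [NeZero (p * e)] [NeZero e]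
    (hpe : p.Coprime e) (h₁ : d ^ 2 * (p * e) ∣ q) (h₂ : d * (p * e) ^ 2 ∣ q)
    (f : CuspSpace k q) {g : ℍ → ℂ} (hg : g ∈ boundedForms k)
    (hinv : g ∣[(k : ℤ)] toReal (lower (q / p)) = g) :
    bracket k g (average q d (p * e) k f) = bracket k g (average q d e k f) := by
  have hd : (d : ℂ) ≠ 0 := by exact_mod_cast NeZero.ne d
  have hp : (p : ℂ) ≠ 0 := by exact_mod_cast NeZero.ne p
  have he : (e : ℂ) ≠ 0 := by exact_mod_cast NeZero.ne e
  have heq : (e : ℚ) ≠ 0 := by exact_mod_cast NeZero.ne e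
  have hpq : (p : ℚ) ≠ 0 := by exact_mod_cast NeZero.ne p
  let v : ℕ → ℂ := fun j => ∑ i : ZMod d, bracket k g
    ((f : ℍ → ℂ) ∣[(k : ℤ)] toReal (lower (j * (q / (p * e))) * upper (i.val / d)))
  have hv' : ∀ j : ℕ, v j = ∑ i : ZMod d, bracket k g
      ((f : ℍ → ℂ) ∣[(k : ℤ)] toReal (upper (i.val / d) * lower (j * (q / (p * e))))) := by
    intro j
    refine Finset.sum_congr rfl fun i _ => ?_
    have := slash_lower_upper_comm f h₁ h₂ i.val j
    push_cast at this
    rw [this]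
  have hv : Function.Periodic v e := by
    intro j
    rw [hv', hv']
    refine Finset.sum_congr rfl fun i _ => ?_
    have h : ((j + e : ℕ) : ℚ) * (q / (p * e)) = j * (q / (p * e)) + q / p := by
      push_cast
      field_simp
    rw [h, lower_add, ← mul_assoc, map_mul, SlashAction.slash_mul]
    exact bracket_slash_right (det_lower _) (slash_mem_of_det_one (det_upper_mul_lower _ _)
      (coe_mem_boundedForms f)) hg hinv
  have key := sum_zmod_mul_of_periodic hpe hv
  rw [bracket_average _ _ f hg, bracket_average _ _ f hg, Finset.sum_comm]
  have e1 : ∑ j : ZMod (p * e), ∑ i : ZMod d, bracket k g ((f : ℍ → ℂ) ∣[(k : ℤ)]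
      toReal (lower (j.val * (q / (p * e : ℕ))) * upper (i.val / d))) =
        ∑ j : ZMod (p * e), v j.val := by
    simp only [v, Nat.cast_mul]
  have e2 : ∑ i : ZMod d, ∑ j : ZMod e, bracket k g ((f : ℍ → ℂ) ∣[(k : ℤ)]
      toReal (lower (j.val * (q / e)) * upper (i.val / d))) =
        ∑ j : ZMod e, v (p * j.val) := by
    rw [Finset.sum_comm]
    refine Finset.sum_congr rfl fun j _ => Finset.sum_congr rfl fun i _ => ?_
    congr 5
    push_cast
    field_simp
  rw [e1, e2, key]
  push_cast
  field_simp

end Projections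

/-! ### Orthonormal expansions and representing forms of Fourier coefficients. -/

section LinearAlgebra

variable {k N : ℕ} [NeZero N] (V : ℝ)

/-- The Petersson product as a linear functional of its second argument. -/
def innerHom (f : CuspSpace k N) : CuspSpace k N →ₗ[ℂ] ℂ where
  toFun := inner V f
  map_add' g h := by
    rw [inner_eq_bracket, inner_eq_bracket, inner_eq_bracket, FunLike.coe_add,
      bracket_add_right (coe_mem_boundedForms f) (coe_mem_boundedForms g) (coe_mem_boundedForms h),
      mul_add]
  map_smul' c g := by
    rw [inner_eq_bracket, inner_eq_bracket, FunLike.coe_smul,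
      bracket_smul_right c (coe_mem_boundedForms f) (coe_mem_boundedForms g), RingHom.id_apply,
      smul_eq_mul]
    ring

lemma inner_conj (f g : CuspSpace k N) : conj (inner V f g) = inner V g f := by
  rw [inner_eq_bracket, inner_eq_bracket, map_mul, Complex.conj_ofReal,
    bracket_conj (coe_mem_boundedForms f) (coe_mem_boundedForms g)]

variable {V} {S : Set (CuspSpace k N)} {B : Finset (CuspSpace k N)}

lemma IsOrthonormalBasis.eq_sum (hB : IsOrthonormalBasis V S B) {f : CuspSpace k N} (hf : f ∈ S) :
    f = ∑ φ ∈ B, inner V φ f • φ := by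
  obtain ⟨c, -, hc⟩ := Submodule.mem_span_finset.mp (hB.spanning hf)
  have h : ∀ φ ∈ B, inner V φ f = c φ := by
    intro φ hφ
    change innerHom V φ f = c φ
    rw [← hc, map_sum, Finset.sum_eq_single φ]
    · rw [map_smul, smul_eq_mul]
      change c φ * inner V φ φ = c φ
      rw [hB.norm_eq_one φ hφ, mul_one]
    · intro ψ hψ hne
      rw [map_smul, smul_eq_mul]
      change c ψ * inner V φ ψ = 0
      rw [hB.orthogonal φ hφ ψ hψ hne.symm, mul_zero]
    · exact fun h => absurd hφ h
  rw [Finset.sum_congr rfl fun φ hφ => by rw [h φ hφ], hc]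

/-- The form representing the functional `rho n` for the Petersson product. -/
lemma IsOrthonormalBasis.exists_inner_eq (hB : IsOrthonormalBasis V Set.univ B) (n : ℕ) :
    ∃ R : CuspSpace k N, ∀ φ, inner V φ R = conj (rho n φ) := by
  refine ⟨∑ ψ ∈ B, conj (rho n ψ) • ψ, fun φ => ?_⟩
  have h : rho n φ = ∑ ψ ∈ B, inner V ψ φ * rho n ψ := by
    change rhoHom n φ = _
    conv_lhs => rw [hB.eq_sum (Set.mem_univ φ), map_sum]
    exact Finset.sum_congr rfl fun ψ _ => by rw [map_smul, smul_eq_mul]; rfl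
  change innerHom V φ _ = _
  rw [map_sum, h, map_sum]
  refine Finset.sum_congr rfl fun ψ _ => ?_
  rw [map_smul, smul_eq_mul, map_mul, inner_conj, mul_comm]
  rfl

/-- `P` is the reproducing form of `S` for `rho n`, so the coefficient sum is the orthonormal
expansion of `P` with `rho m` applied to it. -/
lemma IsOrthonormalBasis.coeffSum_eq (hB : IsOrthonormalBasis V S B) {P : CuspSpace k N}
    (hP : P ∈ S) (m n : ℕ) (h : ∀ φ ∈ B, inner V φ P = conj (rho n φ)) :
    coeffSum B m n = rho m P := by
  change _ = rhoHom m P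
  conv_rhs => rw [hB.eq_sum hP, map_sum]
  refine Finset.sum_congr rfl fun φ hφ => ?_
  rw [map_smul, smul_eq_mul, h φ hφ, mul_comm]
  rfl

end LinearAlgebra

/-! ### Möbius cancellation and divisibility. -/

section Arithmetic

/-- A Möbius sum vanishes if the summand does not change when a fixed prime is added. -/
lemma sum_moebius_mul_eq_zero {q p : ℕ} (hq : q ≠ 0) (hp : p.Prime) (hpq : p ∣ q) (A : ℕ → ℂ)
    (hA : ∀ d, Squarefree (p * d) → p * d ∣ q → A (p * d) = A d) :
    ∑ d ∈ q.divisors, (ArithmeticFunction.moebius d : ℂ) * A d = 0 := by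
  classical
  rw [← Finset.sum_filter_of_ne (p := Squarefree) (fun d _ hd => by
    by_contra hsq
    simp [ArithmeticFunction.moebius_eq_zero_of_not_squarefree hsq] at hd)]
  have hmem : ∀ d, d ∈ q.divisors.filter Squarefree ↔ d ∣ q ∧ Squarefree d := by
    simp [hq]
  have hcop : ∀ {d}, Squarefree d → ¬ p ∣ d → Squarefree (p * d) := fun hd hpd =>
    (Nat.squarefree_mul ((Nat.Prime.coprime_iff_not_dvd hp).mpr hpd)).mpr ⟨hp.prime.squarefree, hd⟩
  have hmul : ∀ {d}, Squarefree (p * d) → ArithmeticFunction.moebius (p * d) =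
      -ArithmeticFunction.moebius d := fun hd => by
    rw [ArithmeticFunction.isMultiplicative_moebius.map_mul_of_coprime
      (Nat.coprime_of_squarefree_mul hd), ArithmeticFunction.moebius_apply_prime hp, neg_one_mul]
  have hdvd : ∀ {d}, d ∣ q → ¬ p ∣ d → p * d ∣ q := fun hd hpd =>
    Nat.Coprime.mul_dvd_of_dvd_of_dvd ((Nat.Prime.coprime_iff_not_dvd hp).mpr hpd) hpq hd
  have hnot : ∀ {d}, Squarefree (p * d) → ¬ p ∣ d := fun hd h =>
    (Nat.Prime.coprime_iff_not_dvd hp).mp (Nat.coprime_of_squarefree_mul hd) h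
  -- Inserting or removing `p` pairs the squarefree divisors with opposite Möbius signs.
  refine Finset.sum_involution (fun d _ => if p ∣ d then d / p else p * d) ?_ ?_ ?_ ?_
  · intro d hd
    obtain ⟨hdq, hsq⟩ := (hmem d).mp hd
    split_ifs with h
    · obtain ⟨t, rfl⟩ := h
      rw [Nat.mul_div_cancel_left _ hp.pos, hmul hsq, hA t hsq hdq]
      push_cast
      ring
    · rw [hmul (hcop hsq h), hA d (hcop hsq h) (hdvd hdq h)]
      push_cast
      ring
  · intro d hd _
    obtain ⟨hdq, hsq⟩ := (hmem d).mp hd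
    have hd0 : 0 < d := Nat.pos_of_ne_zero hsq.ne_zero
    split_ifs with h
    · exact (Nat.div_lt_self hd0 hp.one_lt).ne
    · exact ((Nat.lt_mul_iff_one_lt_left hd0).mpr hp.one_lt).ne'
  · intro d hd
    obtain ⟨hdq, hsq⟩ := (hmem d).mp hd
    rw [hmem]
    split_ifs with h
    · obtain ⟨t, rfl⟩ := h
      rw [Nat.mul_div_cancel_left _ hp.pos]
      exact ⟨(dvd_mul_left t p).trans hdq, hsq.of_mul_right⟩
    · exact ⟨hdvd hdq h, hcop hsq h⟩
  · intro d hd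
    obtain ⟨hdq, hsq⟩ := (hmem d).mp hd
    by_cases h : p ∣ d
    · obtain ⟨t, rfl⟩ := h
      simp [Nat.mul_div_cancel_left _ hp.pos, hnot hsq]
    · simp [h, Nat.mul_div_cancel_left _ hp.pos]

/-- At each prime dividing `q` the exponent on the left is at most `2 + 1 = 3`. -/
lemma mul_dvd_of_squarefree {q : ℕ} (hq : q ≠ 0)
    (hcube : ∀ p : ℕ, p.Prime → p ∣ q → p ^ 3 ∣ q) {d e : ℕ} (hd : Squarefree d)
    (he : Squarefree e) (hdq : d ∣ q) (heq : e ∣ q) : d ^ 2 * e ∣ q := by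
  have hd0 := hd.ne_zero
  have he0 := he.ne_zero
  rw [← Nat.factorization_le_iff_dvd (mul_ne_zero (pow_ne_zero 2 hd0) he0) hq,
    Nat.factorization_mul (pow_ne_zero 2 hd0) he0, Nat.factorization_pow]
  intro p
  simp only [Finsupp.add_apply, Finsupp.smul_apply, smul_eq_mul]
  by_cases hp : p.Prime ∧ p ∣ q
  · have h1 := hd.natFactorization_le_one p
    have h2 := he.natFactorization_le_one p
    have h3 := (hp.1.pow_dvd_iff_le_factorization hq).mp (hcube p hp.1 hp.2)
    omega
  · have h0 : q.factorization p = 0 := by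
      rw [not_and_or] at hp
      rcases hp with hp | hp
      · exact Nat.factorization_eq_zero_of_not_prime q hp
      · exact Nat.factorization_eq_zero_of_not_dvd hp
    have h1 := (Nat.factorization_le_iff_dvd hd0 hq).mpr hdq p
    have h2 := (Nat.factorization_le_iff_dvd he0 hq).mpr heq p
    omega

end Arithmetic

/-! ### The explicit projection to the newspace and its Fourier coefficients. -/

section Newspace

variable {k q : ℕ}

lemma exists_level [NeZero q] (hcube : ∀ p : ℕ, p.Prime → p ∣ q → p ^ 3 ∣ q) {d e : ℕ}
    (hd : Squarefree d) (he : Squarefree e) (hdq : d ∣ q) (heq : e ∣ q) :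
    ∃ M, M ≠ 0 ∧ q = e * (d * M) ∧ d ∣ M ∧ e ∣ d * M := by
  obtain ⟨s, hs⟩ := mul_dvd_of_squarefree (NeZero.ne q) hcube hd he hdq heq
  obtain ⟨t, ht⟩ := mul_dvd_of_squarefree (NeZero.ne q) hcube he hd heq hdq
  have hq : q = e * (d * (d * s)) := by rw [hs]; ring
  refine ⟨d * s, ?_, hq, dvd_mul_right d s, d * t, ?_⟩
  · intro h
    rw [h] at hq
    exact NeZero.ne q (by simpa using hq)
  · refine Nat.eq_of_mul_eq_mul_left (Nat.pos_of_ne_zero he.ne_zero) ?_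
    rw [← hq]
    rw [ht]
    ring

/-- `s` is the average of `f` attached to the squarefree divisors `d` and `e` of `q`. -/
def IsAverage (f : CuspSpace k q) (d e : ℕ) (s : CuspSpace k q) : Prop :=
  ∃ (_ : NeZero d) (_ : NeZero e), (s : ℍ → ℂ) = average q d e k f

lemma exists_isAverage [NeZero q] (hcube : ∀ p : ℕ, p.Prime → p ∣ q → p ^ 3 ∣ q) {d e : ℕ}
    (hd : Squarefree d) (he : Squarefree e) (hdq : d ∣ q) (heq : e ∣ q) (f : CuspSpace k q) :
    ∃ s, IsAverage f d e s := by
  obtain ⟨M, hM, hq, h1, h2⟩ := exists_level hcube hd he hdq heq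
  have : NeZero M := ⟨hM⟩
  have hd' : NeZero d := ⟨hd.ne_zero⟩
  have he' : NeZero e := ⟨he.ne_zero⟩
  obtain ⟨ψ, hψ⟩ := exists_dilate_eq_average hq h1 h2 f
  obtain ⟨s, hs⟩ := exists_cuspForm_dilate (q := q) (d := d) ⟨e, by rw [hq]; ring⟩ ψ
  exact ⟨s, hd', he', hs.trans hψ⟩

lemma IsAverage.eq_self [NeZero q] {f s : CuspSpace k q} (h : IsAverage f 1 1 s) : s = f := by
  obtain ⟨_, _, hs⟩ := h
  apply DFunLike.coe_injective
  have h0 : upper 0 = 1 := by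
    ext i j
    fin_cases i <;> fin_cases j <;> simp
  have h0' : lower 0 = 1 := by
    ext i j
    fin_cases i <;> fin_cases j <;> simp
  have hval : ∀ i : ZMod 1, i.val = 0 := fun i => by
    have := i.val_lt
    omega
  rw [hs, average]
  simp [hval, h0, h0']

lemma IsAverage.mem_oldspace [NeZero q] (hcube : ∀ p : ℕ, p.Prime → p ∣ q → p ^ 3 ∣ q) {d e : ℕ}
    (hd : Squarefree d) (he : Squarefree e) (hdq : d ∣ q) (heq : e ∣ q) {f s : CuspSpace k q}
    (h : IsAverage f d e s) (hne : ¬ (d = 1 ∧ e = 1)) : s ∈ oldspace k q := by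
  obtain ⟨M, hM, hq, h1, h2⟩ := exists_level hcube hd he hdq heq
  have : NeZero M := ⟨hM⟩
  obtain ⟨_, _, hs⟩ := h
  obtain ⟨ψ, hψ⟩ := exists_dilate_eq_average hq h1 h2 f
  refine Submodule.subset_span ⟨M, d, ⟨e * d, by rw [hq]; ring⟩, ?_, ?_, ψ, hs.trans hψ.symm⟩
  · intro hMq
    have h3 : (e * d) * M = 1 * M := by
      rw [one_mul, mul_assoc]
      exact hq.symm.trans hMq.symm
    have h4 := Nat.eq_one_of_mul_eq_one_right (Nat.eq_of_mul_eq_mul_right (Nat.pos_of_ne_zero hM) h3)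
    have h5 := Nat.eq_one_of_mul_eq_one_left (Nat.eq_of_mul_eq_mul_right (Nat.pos_of_ne_zero hM) h3)
    exact hne ⟨h5, h4⟩
  · have : q / M = e * d := by
      rw [hq, ← mul_assoc]
      exact Nat.mul_div_cancel _ (Nat.pos_of_ne_zero hM)
    rw [this]
    exact dvd_mul_left d e

/-- The Fourier coefficients of an average of the form representing `rho n`. -/
lemma IsAverage.rho_eq [NeZero q] (hcube : ∀ p : ℕ, p.Prime → p ∣ q → p ^ 3 ∣ q) {V : ℝ}
    (B : (ℓ : ℕ) → Finset (CuspSpace k ℓ))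
    (hB : ∀ ℓ : ℕ, ℓ ∣ q → IsOrthonormalBasis V Set.univ (B ℓ)) {d e : ℕ}
    (hd : Squarefree d) (he : Squarefree e) (hdq : d ∣ q) (heq : e ∣ q) {R s : CuspSpace k q}
    (h : IsAverage R d e s) (m n : ℕ) (hR : ∀ φ, inner V φ R = conj (rho n φ)) :
    rho m s = if d ∣ m ∧ d ∣ n then coeffSum (B (q / (d * e))) (m / d) (n / d) else 0 := by
  obtain ⟨M, hM, hq, h1, h2⟩ := exists_level hcube hd he hdq heq
  have : NeZero M := ⟨hM⟩
  obtain ⟨_, _, hs⟩ := h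
  obtain ⟨ψ, hψ⟩ := exists_dilate_eq_average hq h1 h2 R
  have hMq : q / (d * e) = M := by
    have hde : 0 < d * e := Nat.mul_pos (Nat.pos_of_ne_zero hd.ne_zero)
      (Nat.pos_of_ne_zero he.ne_zero)
    have : q = d * e * M := by rw [hq]; ring
    rw [this]
    exact Nat.mul_div_cancel_left _ hde
  have hBM := hB M ⟨e * d, by rw [hq]; ring⟩
  rw [hMq, rho_dilate ψ s (hs.trans hψ.symm) m]
  -- Dilate both arguments, replace the average by `R`, and apply the representing property of `R`
  -- to `dilate d φ`.
  have hinner : ∀ φ ∈ B M, inner V φ ψ = if d ∣ n then conj (rho (n / d) φ) else 0 := by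
    intro φ _
    obtain ⟨φ', hφ'⟩ := exists_cuspForm_dilate (q := q) (d := d) ⟨e, by rw [hq]; ring⟩ φ
    rw [inner_eq_bracket, ← bracket_dilate d φ ψ, hψ, bracket_dilate_average hq R φ, ← hφ',
      ← inner_eq_bracket, hR, rho_dilate φ φ' hφ' n]
    split_ifs <;> simp
  by_cases hm : d ∣ m
  · by_cases hn : d ∣ n
    · rw [if_pos hm, if_pos ⟨hm, hn⟩]
      exact (hBM.coeffSum_eq (Set.mem_univ ψ) _ _ fun φ hφ => by
        rw [hinner φ hφ, if_pos hn]).symm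
    · rw [if_pos hm, if_neg fun h => hn h.2]
      have : ψ = 0 := by
        rw [hBM.eq_sum (Set.mem_univ ψ)]
        exact Finset.sum_eq_zero fun φ hφ => by rw [hinner φ hφ, if_neg hn, zero_smul]
      rw [this]
      exact map_zero (rhoHom (m / d))
  · rw [if_neg hm, if_neg fun h => hm h.1]

/-- The signed sum of averages that projects onto the newspace. -/
def newPart (q : ℕ) (s : ℕ → ℕ → CuspSpace k q) : CuspSpace k q :=
  ∑ d ∈ q.divisors, ∑ e ∈ q.divisors,
    ((ArithmeticFunction.moebius d * ArithmeticFunction.moebius e : ℤ) : ℂ) • s d e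

lemma inner_newPart [NeZero q] (V : ℝ) (g : CuspSpace k q) (s : ℕ → ℕ → CuspSpace k q) :
    inner V g (newPart q s) = ∑ d ∈ q.divisors, ∑ e ∈ q.divisors,
      ((ArithmeticFunction.moebius d * ArithmeticFunction.moebius e : ℤ) : ℂ) *
        inner V g (s d e) := by
  change innerHom V g _ = _
  simp only [newPart, map_sum, map_smul, smul_eq_mul]
  rfl

/-- It is enough to test generators `dilate d₀ φ` of level `ℓ`. A prime `p ∣ d₀`, or `p ∣ q / ℓ` if
`d₀ = 1`, supplies a translation fixing the generator, and the sum over `d`, respectively `e`, then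
cancels. -/
lemma newPart_mem_newspace [NeZero q] (hcube : ∀ p : ℕ, p.Prime → p ∣ q → p ^ 3 ∣ q) (V : ℝ)
    {f : CuspSpace k q} {s : ℕ → ℕ → CuspSpace k q}
    (hs : ∀ d e, Squarefree d → Squarefree e → d ∣ q → e ∣ q → IsAverage f d e (s d e)) :
    newPart q s ∈ newspace V k q := by
  intro g hg
  -- The product is linear only in the second argument; after conjugation, orthogonality to `g` is
  -- membership in a kernel and can be checked on the spanning set.
  suffices h : conj (inner V (newPart q s) g) = 0 by rwa [inner_conj] at h
  rw [map_eq_zero]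
  change g ∈ LinearMap.ker (innerHom V (newPart q s))
  refine Submodule.span_le.mpr ?_ hg
  rintro g ⟨ℓ, d₀, hℓ, hne, hd₀, φ, hgφ⟩
  change inner V (newPart q s) g = 0
  rw [← inner_conj, map_eq_zero, inner_newPart]
  have hg' := coe_mem_boundedForms g
  have hq0 : q ≠ 0 := NeZero.ne q
  obtain ⟨t, ht⟩ := hℓ
  have hℓ0 : ℓ ≠ 0 := by
    rintro rfl
    simp at ht
    exact hq0 ht
  have htq : q / ℓ = t := by rw [ht]; exact Nat.mul_div_cancel_left t (Nat.pos_of_ne_zero hℓ0)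
  rw [htq] at hd₀
  have ht0 : t ≠ 0 := by
    rintro rfl
    simp at ht
    exact hq0 ht
  have : NeZero d₀ := ⟨fun h => ht0 (by simpa [h] using hd₀)⟩
  have hd₀q : d₀ ∣ q := hd₀.trans ⟨ℓ, by rw [ht]; ring⟩
  by_cases h1 : d₀ = 1
  · have ht1 : t ≠ 1 := fun h => hne (by rw [ht, h, mul_one])
    obtain ⟨p, hp, hpt⟩ := Nat.exists_prime_and_dvd ht1
    have hpq : p ∣ q := hpt.trans ⟨ℓ, by rw [ht]; ring⟩
    have hp0 : NeZero p := ⟨hp.ne_zero⟩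
    have hinv : (g : ℍ → ℂ) ∣[(k : ℤ)] toReal (lower (q / p)) = g := by
      obtain ⟨u, hu⟩ := hpt
      have hpQ : (p : ℚ) ≠ 0 := by exact_mod_cast hp.ne_zero
      rw [hgφ, h1]
      refine dilate_slash_lower (n := u) 1 φ ?_
      rw [ht, hu]
      push_cast
      field_simp
    refine Finset.sum_eq_zero fun d hd => ?_
    by_cases hsq : Squarefree d
    swap
    · simp [ArithmeticFunction.moebius_eq_zero_of_not_squarefree hsq]
    have hdq := Nat.dvd_of_mem_divisors hd
    have := sum_moebius_mul_eq_zero hq0 hp hpq (fun e => inner V g (s d e)) (by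
      intro e hsqe hdvd
      have he := hsqe.of_mul_right
      obtain ⟨_, _, e1⟩ := hs d e hsq he hdq ((dvd_mul_left e p).trans hdvd)
      obtain ⟨_, _, e2⟩ := hs d (p * e) hsq hsqe hdq hdvd
      rw [inner_eq_bracket, inner_eq_bracket, e1, e2, bracket_average_mul_right
        (Nat.coprime_of_squarefree_mul hsqe)
        (mul_dvd_of_squarefree hq0 hcube hsq hsqe hdq hdvd)
        (by
          rw [mul_comm]
          exact mul_dvd_of_squarefree hq0 hcube hsqe hsq hdvd hdq) f hg' hinv])
    rw [← mul_zero (ArithmeticFunction.moebius d : ℂ), ← this, Finset.mul_sum]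
    refine Finset.sum_congr rfl fun e _ => ?_
    push_cast
    ring
  · obtain ⟨p, hp, hpd⟩ := Nat.exists_prime_and_dvd h1
    have hpq : p ∣ q := hpd.trans hd₀q
    have hp0 : NeZero p := ⟨hp.ne_zero⟩
    have hinv : (g : ℍ → ℂ) ∣[(k : ℤ)] toReal (upper (1 / p)) = g := by
      obtain ⟨u, hu⟩ := hpd
      have hpQ : (p : ℚ) ≠ 0 := by exact_mod_cast hp.ne_zero
      rw [hgφ]
      refine dilate_slash_upper (n := u) d₀ φ ?_
      rw [hu]
      push_cast
      field_simp
    rw [Finset.sum_comm]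
    refine Finset.sum_eq_zero fun e he => ?_
    by_cases hsq : Squarefree e
    swap
    · simp [ArithmeticFunction.moebius_eq_zero_of_not_squarefree hsq]
    have heq := Nat.dvd_of_mem_divisors he
    have := sum_moebius_mul_eq_zero hq0 hp hpq (fun d => inner V g (s d e)) (by
      intro d hsqd hdvd
      have hd := hsqd.of_mul_right
      obtain ⟨_, _, e1⟩ := hs d e hd hsq ((dvd_mul_left d p).trans hdvd) heq
      obtain ⟨_, _, e2⟩ := hs (p * d) e hsqd hsq hdvd heq
      rw [inner_eq_bracket, inner_eq_bracket, e1, e2, bracket_average_mul_left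
        (Nat.coprime_of_squarefree_mul hsqd) f hg' hinv])
    rw [← mul_zero (ArithmeticFunction.moebius e : ℂ), ← this, Finset.mul_sum]
    refine Finset.sum_congr rfl fun d _ => ?_
    push_cast
    ring

lemma sub_newPart_mem_oldspace [NeZero q] (hcube : ∀ p : ℕ, p.Prime → p ∣ q → p ^ 3 ∣ q)
    {f : CuspSpace k q} {s : ℕ → ℕ → CuspSpace k q}
    (hs : ∀ d e, Squarefree d → Squarefree e → d ∣ q → e ∣ q → IsAverage f d e (s d e)) :
    newPart q s - f ∈ oldspace k q := by
  have hq0 : q ≠ 0 := NeZero.ne q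
  have h11 : s 1 1 = f :=
    (hs 1 1 squarefree_one squarefree_one (one_dvd q) (one_dvd q)).eq_self
  have hterm : ∀ d ∈ q.divisors, ∀ e ∈ q.divisors, ¬ (d = 1 ∧ e = 1) →
      ((ArithmeticFunction.moebius d * ArithmeticFunction.moebius e : ℤ) : ℂ) • s d e ∈
        oldspace k q := by
    intro d hd e he hne
    by_cases hsq : Squarefree d ∧ Squarefree e
    · have hdq := Nat.dvd_of_mem_divisors hd
      have heq := Nat.dvd_of_mem_divisors he
      exact Submodule.smul_mem _ _ ((hs d e hsq.1 hsq.2 hdq heq).mem_oldspace hcube hsq.1 hsq.2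
        hdq heq hne)
    · rw [not_and_or] at hsq
      rcases hsq with h | h <;>
        simp [ArithmeticFunction.moebius_eq_zero_of_not_squarefree h]
  have hmem : ((1, 1) : ℕ × ℕ) ∈ q.divisors ×ˢ q.divisors := by simp [hq0]
  rw [newPart, ← Finset.sum_product', ← Finset.add_sum_erase _ _ hmem]
  simp only [ArithmeticFunction.moebius_apply_one, mul_one, Int.cast_one, one_smul, h11,
    add_sub_cancel_left]
  refine Submodule.sum_mem _ fun x hx => ?_
  obtain ⟨hx1, hx2⟩ := Finset.mem_erase.mp hx
  rw [Finset.mem_product] at hx2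
  exact hterm x.1 hx2.1 x.2 hx2.2 fun h => hx1 (Prod.ext h.1 h.2)

end Newspace

end NewformAverage

end


/-- `Bstar` is any orthonormal basis of the newspace `𝒜*(q)` and `B ℓ`, for `ℓ ∣ q`, any orthonormal
basis of `𝒜(ℓ)`, with respect to hyperbolic measures of a common total volume `V`. In the terms with
`μ d * μ e ≠ 0` one has `d * e ∣ q`, so that all the divisions are exact. -/
theorem mainTheorem5 (k : ℕ) (hk : 0 < k) (q : ℕ) (hq : 0 < q)
    (hcube : ∀ p : ℕ, p.Prime → p ∣ q → p ^ 3 ∣ q)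
    (V : ℝ) (hV : 0 < V)
    (Bstar : Finset (NewformAverage.CuspSpace k q))
    (hBstar : NewformAverage.IsOrthonormalBasis V (NewformAverage.newspace V k q) Bstar)
    (B : (ℓ : ℕ) → Finset (NewformAverage.CuspSpace k ℓ))
    (hB : ∀ ℓ : ℕ, ℓ ∣ q → NewformAverage.IsOrthonormalBasis V Set.univ (B ℓ))
    (m n : ℕ) (hm : 0 < m) (hn : 0 < n) :
    NewformAverage.coeffSum Bstar m n =
      ∑ d ∈ ((m.gcd n).gcd q).divisors, ∑ e ∈ q.divisors,
        ((ArithmeticFunction.moebius d * ArithmeticFunction.moebius e : ℤ) : ℂ) *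
          NewformAverage.coeffSum (B (q / (d * e))) (m / d) (n / d) := by
  open NewformAverage in
  have hqz : NeZero q := ⟨hq.ne'⟩
  obtain ⟨R, hR⟩ := (hB q dvd_rfl).exists_inner_eq n
  -- Averages exist only for squarefree divisors; elsewhere `s d e` is arbitrary and the Möbius
  -- factor or the range of summation removes it.
  have hex : ∀ d e, ∃ s : CuspSpace k q, Squarefree d → Squarefree e → d ∣ q → e ∣ q →
      IsAverage R d e s := by
    intro d e
    by_cases h : Squarefree d ∧ Squarefree e ∧ d ∣ q ∧ e ∣ q
    · obtain ⟨s, hs⟩ := exists_isAverage hcube h.1 h.2.1 h.2.2.1 h.2.2.2 R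
      exact ⟨s, fun _ _ _ _ => hs⟩
    · exact ⟨0, fun h1 h2 h3 h4 => absurd ⟨h1, h2, h3, h4⟩ h⟩
  choose s hs using hex
  have hcoeff : coeffSum Bstar m n = rho m (newPart q s) := by
    refine hBstar.coeffSum_eq (newPart_mem_newspace hcube V hs) m n fun φ hφ => ?_
    -- The difference is an oldform, so `newPart q s` represents `rho n` on the newspace just as `R`
    -- does.
    have horth : inner V φ (newPart q s - R) = 0 := by
      rw [← inner_conj, hBstar.subset hφ _ (sub_newPart_mem_oldspace hcube hs), map_zero]
    rw [← hR φ]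
    exact sub_eq_zero.mp ((map_sub (innerHom V φ) _ _).symm.trans horth)
  have hrho : rho m (newPart q s) = ∑ d ∈ q.divisors, ∑ e ∈ q.divisors,
      ((ArithmeticFunction.moebius d * ArithmeticFunction.moebius e : ℤ) : ℂ) *
        rho m (s d e) := by
    change rhoHom m _ = _
    simp only [newPart, map_sum, map_smul, smul_eq_mul]
    rfl
  have hsub : ((m.gcd n).gcd q).divisors ⊆ q.divisors :=
    Nat.divisors_subset_of_dvd hq.ne' (Nat.gcd_dvd_right _ _)
  have hterm : ∀ d ∈ q.divisors, ∀ e ∈ q.divisors,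
      ((ArithmeticFunction.moebius d * ArithmeticFunction.moebius e : ℤ) : ℂ) * rho m (s d e) =
        ((ArithmeticFunction.moebius d * ArithmeticFunction.moebius e : ℤ) : ℂ) *
          if d ∣ m ∧ d ∣ n then coeffSum (B (q / (d * e))) (m / d) (n / d) else 0 := by
    intro d hd e he
    by_cases hsq : Squarefree d ∧ Squarefree e
    · have hdq := Nat.dvd_of_mem_divisors hd
      have heq := Nat.dvd_of_mem_divisors he
      rw [(hs d e hsq.1 hsq.2 hdq heq).rho_eq hcube B hB hsq.1 hsq.2 hdq heq m n hR]
    · rw [not_and_or] at hsq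
      rcases hsq with h | h <;>
        simp [ArithmeticFunction.moebius_eq_zero_of_not_squarefree h]
  rw [hcoeff, hrho, Finset.sum_congr rfl fun d hd => Finset.sum_congr rfl (hterm d hd),
    ← Finset.sum_subset hsub]
  · refine Finset.sum_congr rfl fun d hd => Finset.sum_congr rfl fun e _ => ?_
    have hdg := (Nat.dvd_of_mem_divisors hd).trans (Nat.gcd_dvd_left _ _)
    rw [if_pos ⟨hdg.trans (Nat.gcd_dvd_left _ _), hdg.trans (Nat.gcd_dvd_right _ _)⟩]
  · intro d hd hnd
    refine Finset.sum_eq_zero fun e _ => ?_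
    rw [if_neg, mul_zero]
    rintro ⟨h1, h2⟩
    refine hnd (Nat.mem_divisors.mpr ⟨Nat.dvd_gcd (Nat.dvd_gcd h1 h2)
      (Nat.dvd_of_mem_divisors hd), ?_⟩)
    exact (Nat.gcd_pos_of_pos_right _ hq).ne'
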